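/- Conventions. Fix $d\ge 1$ and a finite alphabet $\mathcal A$. A $d$-dimensional subshift is a closed (for the product of the discrete topologies) subset $\Sigma\subset\mathcal A^{\mathbb Z^d}$ invariant under all shifts. For finite $U\subset\mathbb Z^d$, $\mathcal L_U(\Sigma)\subset\mathcal A^U$ is the set of patterns $x|_U$, $x\in\Sigma$; $\mathcal L(\Sigma)=\bigcup_U\mathcal L_U(\Sigma)$ is the language and $\mathcal L_n(\Sigma)=\mathcal L_{[0,n-1]^d}(\Sigma)$. The subshift is decidable if some algorithm, given a finite pattern (as a list of pairs position/symbol), halts and tells whether it belongs to $\mathcal L(\Sigma)$. Its entropy is $h(\Sigma)=\lim_{n\to\infty}\log_2(\#\mathcal L_n(\Sigma))/n^d$. For $f:\mathbb N\to\mathbb N$, $\Sigma$ is $f$-irreducible if for every $n$, all finite $U,V\subset\mathbb Z^d$ of diameter at most $n$ with $\min_{i\in U,\,j\in V}d(i,j)>f(n)$ (Chebyshev distance), and all $u\in\mathcal L_U(\Sigma)$, $v\in\mathcal L_V(\Sigma)$, there is $x\in\Sigma$ with $x|_U=u$ and $x|_V=v$. A real $\alpha$ is $\Pi_1$-computable if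 $\alpha=\inf_n\varphi(n)$ for some computable $\varphi:\mathbb N\to\mathbb Q$. Theorem. Let $f:\mathbb N\to\mathbb N$ be a computable non-decreasing function such that $f(n+1)-f(n)\in\{0,1\}$ for all $n$ and $\sum_{n\ge1} f(n)/n^2=+\infty$, and let $d\ge1$. (1) For every $\Pi_1$-computable real $\alpha>0$ there exist a finite alphabet and a decidable $f$-irreducible $d$-dimensional subshift over it with entropy exactly $\alpha$. (2) Consequently, no algorithm computes the entropy of decidable $f$-irreducible $d$-dimensional subshifts, even over a suitable fixed alphabet: there is a finite alphabet for which there is no algorithm that, given any program deciding the language of a nonempty $f$-irreducible $d$-dimensional subshift $\Sigma$ over this alphabet and given $n\in\mathbb N$, halts and returns a rational number $r$ with $|h(\Sigma)-r|\le 2^{-n}$. -/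

import Mathlib

namespace EntropyIrr

open Filter Topology SymbolicDynamics.FullShift

/-- A subshift on the alphabet `{0, …, k-1}` (discrete topology) in dimension `d`: a closed subset
of `(Fin k)^(ℤ^d)` that is invariant under all shifts. -/
abbrev ZSubshift (d k : ℕ) : Type := Subshift (Fin k) (Fin d → ℤ)

/-- `L_U(X)`: the patterns `u ∈ A^U` on the finite set `U` that appear in some point of `X`. -/
def languageOn {d k : ℕ} (X : ZSubshift d k) (U : Finset (Fin d → ℤ)) : Set (U → Fin k) :=
  {u | ∃ x ∈ X.carrier, ∀ i : U, x i = u i}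

/-- The cube `[0, n-1]^d`. -/
noncomputable def box (d n : ℕ) : Finset (Fin d → ℤ) :=
  Fintype.piFinset fun _ => Finset.Ico (0 : ℤ) n

/-- `X` has topological entropy `h`: `log₂ #L_n(X) / n^d → h`. -/
def HasEntropy {d k : ℕ} (X : ZSubshift d k) (h : ℝ) : Prop :=
  Tendsto (fun n : ℕ => Real.logb 2 ((languageOn X (box d n)).ncard : ℝ) / (n : ℝ) ^ d)
    atTop (𝓝 h)

/-- `f`-irreducibility. The distance on `Fin d → ℤ` is the Chebyshev distance. -/
def IsIrreducible {d k : ℕ} (f : ℕ → ℕ) (X : ZSubshift d k) : Prop :=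
  ∀ (n : ℕ) (U V : Finset (Fin d → ℤ)),
    (∀ i ∈ U, ∀ j ∈ U, dist i j ≤ n) → (∀ i ∈ V, ∀ j ∈ V, dist i j ≤ n) →
    (∀ i ∈ U, ∀ j ∈ V, (f n : ℝ) < dist i j) →
    ∀ u ∈ languageOn X U, ∀ v ∈ languageOn X V,
      ∃ x ∈ X.carrier, (∀ i : U, x i = u i) ∧ (∀ j : V, x j = v j)

/-- Finite patterns are given to algorithms as finite lists of pairs (position, symbol). The list
`w` encodes the pattern `u` on `U` when its entries are exactly the pairs `(i, u i)`, `i ∈ U`. -/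
def Encodes {d k : ℕ} (w : List ((Fin d → ℤ) × Fin k)) {U : Finset (Fin d → ℤ)}
    (u : U → Fin k) : Prop :=
  ∀ i a, (i, a) ∈ w ↔ ∃ h : i ∈ U, u ⟨i, h⟩ = a

/-- The encoded language of `X`: the lists that encode a pattern of `L(X) = ⋃_U L_U(X)`. -/
def language {d k : ℕ} (X : ZSubshift d k) : Set (List ((Fin d → ℤ) × Fin k)) :=
  {w | ∃ U : Finset (Fin d → ℤ), ∃ u ∈ languageOn X U, Encodes w u}

theorem mem_language_iff {d k : ℕ} (X : ZSubshift d k) (w : List ((Fin d → ℤ) × Fin k)) :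
    w ∈ language X ↔ ∃ x ∈ X.carrier, ∀ p ∈ w, x p.1 = p.2 := by
  constructor
  · rintro ⟨U, u, ⟨x, hx, hxu⟩, hw⟩
    refine ⟨x, hx, fun p hp => ?_⟩
    obtain ⟨h, e⟩ := (hw p.1 p.2).1 hp
    rw [← e, ← hxu]
  · rintro ⟨x, hx, hw⟩
    classical
    refine ⟨(w.map Prod.fst).toFinset, fun i => x i, ⟨x, hx, fun _ => rfl⟩, fun i a => ?_⟩
    constructor
    · intro h
      exact ⟨by simpa using ⟨a, h⟩, hw _ h⟩
    · rintro ⟨h, e⟩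
      obtain ⟨b, hb⟩ : ∃ b, (i, b) ∈ w := by simpa using h
      have := hw _ hb
      simp only at this e
      rw [← e, this]
      exact hb

/-- `X` is decidable: its language is decidable. -/
def IsDecidable {d k : ℕ} (X : ZSubshift d k) : Prop :=
  ComputablePred fun w : List ((Fin d → ℤ) × Fin k) => w ∈ language X

/-- The Gödel number of an encoded pattern, in the encoding that underlies computability of
predicates on such lists. -/
def patternCode {d k : ℕ} (w : List ((Fin d → ℤ) × Fin k)) : ℕ :=
  @Encodable.encode _ Primcodable.toEncodable w

/-- The program `c` decides the language of `X`: on every encoded input it halts and returns `1`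
if the input is in the language and `0` otherwise. -/
def Decides {d k : ℕ} (c : Nat.Partrec.Code) (X : ZSubshift d k) : Prop :=
  ∀ w : List ((Fin d → ℤ) × Fin k),
    (w ∈ language X → 1 ∈ c.eval (patternCode w)) ∧
    (w ∉ language X → 0 ∈ c.eval (patternCode w))

/-- A computable sequence of rationals, each given by a numerator and a denominator. -/
def IsComputableRatSeq (φ : ℕ → ℚ) : Prop :=
  ∃ (p : ℕ → ℤ) (q : ℕ → ℕ), Computable p ∧ Computable q ∧
    ∀ n, q n ≠ 0 ∧ φ n = (p n : ℚ) / (q n : ℚ)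

/-- `α` is `Π₁`-computable: the infimum of a computable sequence of rationals. -/
def IsPi1Computable (α : ℝ) : Prop :=
  ∃ φ : ℕ → ℚ, IsComputableRatSeq φ ∧ IsGLB (Set.range fun n => (φ n : ℝ)) α

/-- The (partial) algorithm `alg` computes the entropy of all nonempty `f`-irreducible decidable
subshifts in dimension `d` over the alphabet `{0, …, k-1}`: given any program `c` that decides the
language of such a subshift `X` and given `n`, it halts and returns a fraction (numerator,
denominator) that approximates the entropy of `X` within `2^{-n}`. -/
def ComputesEntropy (f : ℕ → ℕ) (d k : ℕ) (alg : Nat.Partrec.Code × ℕ →. ℤ × ℕ) : Prop :=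
  ∀ X : ZSubshift d k, X.carrier.Nonempty → IsIrreducible f X →
    ∀ c : Nat.Partrec.Code, Decides c X → ∀ h : ℝ, HasEntropy X h →
      ∀ n : ℕ, ∃ r ∈ alg (c, n), r.2 ≠ 0 ∧ |h - (r.1 : ℝ) / (r.2 : ℝ)| ≤ (2 : ℝ)⁻¹ ^ n

end EntropyIrr

/-!
Fix a function `p`, the density profile. The subshift `densityShift` consists of the configurations
over `{0, …, K}` in which every window of length `m` in a row in the first direction holds at most
`p m` nonzero symbols. Blocks of lengths `a ≥ b` whose windows obey these bounds can be glued at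
distance `G a` if `p a + p b ≤ p (a + b + G a)`, so the subshift is `f`-irreducible as soon as
`G (n + 1) ≤ f n`, and the rows are independent, so its entropy is that of the one-dimensional
blocks.

The profile and the gap function are computed together, length by length: `p` is the least function
with this gluing property, and `G` increases by one, within the bound given by `f`, exactly while
the number of blocks of the current length shows that the entropy could exceed `α`. If the gap
increases infinitely often, there are thus arbitrarily long lengths with sufficiently many blocks
for the entropy to be at least `α`; if it increases for the last time, gluing copies of the blocks
of that length at the final distance shows the same. If the entropy were larger than `α`, the gap
would eventually increase whenever `f` allows it, so that the series of `G n / n²` diverges with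
that of `f n / n²`. But each increase of the gap at a length `n` lowers the bound on the density
`p m / m` by the factor `exp (-1 / (5 n))`, hence the density, and with it the entropy, would be
zero.

The bounds on `α` from above that are seen up to time `n` may depend on a program: an entropy that
drops from `1` to `1 / 2` once the program halts makes the computation of entropies undecidable.
-/

namespace EntropyIrr

open Filter Topology SymbolicDynamics.FullShift

/-! ### Density profiles -/

theorem tendsto_div_zero_of_summable_div_sq {g : ℕ → ℝ} (hg : Monotone g) (h0 : ∀ n, 0 ≤ g n)
    (hsum : Summable fun n : ℕ => g n / (n : ℝ) ^ 2) :
    Tendsto (fun n : ℕ => g n / n) atTop (𝓝 0) := by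
  set S : ℕ → ℝ := fun n => ∑ k ∈ Finset.range n, g k / (k : ℝ) ^ 2
  have hlim : Tendsto (fun n => 4 * (S (2 * n) - S n)) atTop (𝓝 0) := by
    have htotal := hsum.hasSum.tendsto_sum_nat
    have hdouble := htotal.comp (tendsto_id.const_mul_atTop' (show 0 < 2 by norm_num))
    simpa using (hdouble.sub htotal).const_mul 4
  refine squeeze_zero (fun n => div_nonneg (h0 n) n.cast_nonneg) (fun n => ?_) hlim
  rcases n.eq_zero_or_pos with rfl | hn
  · simp
  have : (0 : ℝ) < n := by exact_mod_cast hn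
  have hterm : ∀ k ∈ Finset.Ico n (2 * n), g n / (4 * (n : ℝ) ^ 2) ≤ g k / (k : ℝ) ^ 2 := by
    intro k hk
    obtain ⟨hnk, hk2⟩ := Finset.mem_Ico.1 hk
    have hk0 : (0 : ℝ) < k := by exact_mod_cast hn.trans_le hnk
    have hk2' : (k : ℝ) ≤ 2 * n := by exact_mod_cast hk2.le
    exact div_le_div₀ (h0 k) (hg hnk) (by positivity) (by nlinarith)
  have hcard := Finset.card_nsmul_le_sum _ _ _ hterm
  rw [Nat.card_Ico, show 2 * n - n = n by omega, nsmul_eq_mul,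
    Finset.sum_Ico_eq_sub _ (by omega)] at hcard
  calc g n / n = 4 * (n * (g n / (4 * (n : ℝ) ^ 2))) := by field_simp
    _ ≤ 4 * (S (2 * n) - S n) := by gcongr

theorem summable_div_sq_of_eventually_le {f g : ℕ → ℕ}
    (hg : Summable fun n : ℕ => (g n : ℝ) / (n : ℝ) ^ 2) (h : ∀ᶠ n in atTop, f n ≤ g (2 * n)) :
    Summable fun n : ℕ => (f n : ℝ) / (n : ℝ) ^ 2 := by
  have hdouble := (hg.comp_injective (mul_right_injective₀ (two_ne_zero' ℕ))).mul_left 4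
  refine Summable.of_norm_bounded_eventually_nat hdouble ?_
  filter_upwards [h] with n hn
  have hn' : (f n : ℝ) ≤ g (2 * n) := by exact_mod_cast hn
  rw [Real.norm_of_nonneg (by positivity)]
  calc (f n : ℝ) / (n : ℝ) ^ 2 ≤ g (2 * n) / (n : ℝ) ^ 2 := by gcongr
    _ = 4 * (g (2 * n) / ((2 * n : ℕ) : ℝ) ^ 2) := by push_cast; ring

theorem not_summable_of_tendsto_sum_Icc {g : ℕ → ℝ} (h0 : ∀ n, 0 ≤ g n)
    (h : Tendsto (fun N => ∑ n ∈ Finset.Icc 1 N, g n) atTop atTop) : ¬ Summable g := fun hg =>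
  not_tendsto_atTop_of_tendsto_nhds tendsto_const_nhds
    (tendsto_atTop_mono (fun N => hg.sum_le_tsum (Finset.Icc 1 N) fun n _ => h0 n) h)

/-- A density profile `p` with gaps `G`: two blocks of lengths `b ≤ a` that are `G a` apart may be
filled up to their bounds, and `p` grows only as this rule forces it to. -/
structure IsProfile (p G : ℕ → ℕ) : Prop where
  zero : p 0 = 0
  one : p 1 = 1
  mono : Monotone p
  glue : ∀ a b, b ≤ a → p a + p b ≤ p (a + b + G a)
  succ_le : ∀ n, 1 ≤ n → p (n + 1) ≤ p n ∨
    ∃ a b, b ≤ a ∧ a ≤ n ∧ a + b + G a ≤ n + 1 ∧ p (n + 1) ≤ p a + p b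
  gap_one : G 1 = 0
  gap_succ : ∀ n, G (n + 1) = G n ∨ G (n + 1) = G n + 1

/-- The sum of the increments of the gap function, an increment at length `k` having weight
`1 / k`; the density of a profile decays exponentially in it. -/
noncomputable def gapSum (G : ℕ → ℕ) (n : ℕ) : ℝ :=
  ∑ k ∈ Finset.Ico 1 n, ((G (k + 1) : ℝ) - G k) / k

theorem gapSum_succ (G : ℕ → ℕ) {n : ℕ} (hn : 1 ≤ n) :
    gapSum G (n + 1) = gapSum G n + ((G (n + 1) : ℝ) - G n) / n :=
  Finset.sum_Ico_succ_top hn _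

namespace IsProfile

variable {p G : ℕ → ℕ}

theorem gap_mono (h : IsProfile p G) : Monotone G :=
  monotone_nat_of_le_succ fun n => by rcases h.gap_succ n with e | e <;> omega

theorem gap_le_self (h : IsProfile p G) (n : ℕ) : G n ≤ n := by
  induction n with
  | zero => exact (h.gap_mono zero_le_one).trans_eq h.gap_one
  | succ n ih => rcases h.gap_succ n with e | e <;> omega

theorem le_self (h : IsProfile p G) (n : ℕ) : p n ≤ n := by
  induction n using Nat.strong_induction_on with
  | _ n ih =>
    rcases n with _ | n
    · exact h.zero.le
    rcases Nat.eq_zero_or_pos n with rfl | hn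
    · exact h.one.le
    rcases h.succ_le n hn with e | ⟨a, b, hba, han, hab, e⟩
    · have := ih n (by omega)
      omega
    · have := ih a (by omega)
      have := ih b (by omega)
      omega

theorem glue_of_le (h : IsProfile p G) {n c : ℕ} (hc : G n ≤ c) {a b : ℕ} (ha : a ≤ n)
    (hb : b ≤ n) : p a + p b ≤ p (a + b + c) := by
  wlog hab : b ≤ a generalizing a b
  · rw [add_comm, add_comm a]
    exact this hb ha (le_of_not_ge hab)
  have := h.gap_mono ha
  exact (h.glue a b hab).trans (h.mono (by omega))

theorem sum_gap_div_sq_le (h : IsProfile p G) {n : ℕ} (hn : 1 ≤ n) :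
    ∑ k ∈ Finset.range (n + 1), (G k : ℝ) / (k : ℝ) ^ 2 + (G n : ℝ) / n ≤ gapSum G n := by
  induction n, hn using Nat.le_induction with
  | base => simp [Finset.sum_range_succ, gapSum, h.gap_one]
  | succ n hn ih =>
    have : (0 : ℝ) < n := by exact_mod_cast hn
    rw [Finset.sum_range_succ, gapSum_succ G hn, sub_div]
    have hstep : (G (n + 1) : ℝ) / ((n + 1 : ℕ) : ℝ) ^ 2 + G (n + 1) / ((n + 1 : ℕ) : ℝ)
        ≤ G (n + 1) / n := by
      push_cast
      rw [← sub_nonneg]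
      have : (G (n + 1) : ℝ) / n - (G (n + 1) / ((n : ℝ) + 1) ^ 2 + G (n + 1) / ((n : ℝ) + 1))
          = G (n + 1) / (n * ((n : ℝ) + 1) ^ 2) := by field_simp; ring
      rw [this]
      positivity
    linarith

theorem tendsto_gapSum (h : IsProfile p G)
    (hG : ¬ Summable fun n : ℕ => (G n : ℝ) / (n : ℝ) ^ 2) : Tendsto (gapSum G) atTop atTop := by
  rw [not_summable_iff_tendsto_nat_atTop_of_nonneg fun n => by positivity] at hG
  refine tendsto_atTop_mono' atTop ?_ (hG.comp (tendsto_add_atTop_nat 1))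
  filter_upwards [eventually_ge_atTop 1] with n hn
  exact (le_add_of_nonneg_right (by positivity)).trans (h.sum_gap_div_sq_le hn)

/-- If `p m ≤ δ (m + G n)` for all `m`, then `δ` may be lowered as soon as the new bound holds up
to length `2 n + G n`: longer blocks split at gaps of at least `G (n + 1)`. -/
theorem le_mul_add_gap_succ (h : IsProfile p G) {n : ℕ} (hn : 1 ≤ n) {δ δ' : ℝ} (hδ' : 0 ≤ δ')
    (hδ : ∀ m, (p m : ℝ) ≤ δ * (m + G n))
    (hδδ' : ∀ m, m ≤ 2 * n + G n → δ * (m + G n) ≤ δ' * (m + G (n + 1))) (m : ℕ) :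
    (p m : ℝ) ≤ δ' * (m + G (n + 1)) := by
  induction m using Nat.strong_induction_on with
  | _ m ih =>
    by_cases hm : m ≤ 2 * n + G n
    · exact (hδ m).trans (hδδ' m hm)
    obtain ⟨m, rfl⟩ : ∃ m', m = m' + 1 := ⟨m - 1, by omega⟩
    rcases h.succ_le m (by omega) with e | ⟨a, b, hba, ham, hab, e⟩
    · calc (p (m + 1) : ℝ) ≤ p m := by exact_mod_cast e
        _ ≤ δ' * (m + G (n + 1)) := ih m (by omega)
        _ ≤ _ := by gcongr; omega
    have e' : (p (m + 1) : ℝ) ≤ p a + p b := by exact_mod_cast e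
    by_cases ha : n + 1 ≤ a
    · have hG := h.gap_mono ha
      have hlen : (a : ℝ) + b + G (n + 1) ≤ (m + 1 : ℕ) := by exact_mod_cast (by omega)
      calc (p (m + 1) : ℝ) ≤ δ' * (a + G (n + 1)) + δ' * (b + G (n + 1)) :=
            e'.trans (add_le_add (ih a (by omega)) (ih b (by omega)))
        _ = δ' * (a + b + G (n + 1) + G (n + 1)) := by ring
        _ ≤ _ := by gcongr
    · have hG := h.gap_mono (show a ≤ n by omega)
      calc (p (m + 1) : ℝ) ≤ p (a + b + G a) := e'.trans (by exact_mod_cast h.glue a b hba)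
        _ ≤ δ' * ((a + b + G a : ℕ) + G (n + 1)) := ih _ (by omega)
        _ ≤ _ := by gcongr

theorem le_exp_gapSum (h : IsProfile p G) {n : ℕ} (hn : 1 ≤ n) (m : ℕ) :
    (p m : ℝ) ≤ Real.exp (-gapSum G n / 5) * (m + G n) := by
  induction n, hn using Nat.le_induction generalizing m with
  | base => simpa [gapSum, h.gap_one] using h.le_self m
  | succ n hn ih =>
    refine h.le_mul_add_gap_succ hn (Real.exp_nonneg _) ih (fun m hm => ?_) m
    have : (0 : ℝ) < n := by exact_mod_cast hn
    have hexp : -gapSum G (n + 1) / 5 =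
        -gapSum G n / 5 + -(((G (n + 1) : ℝ) - G n) / (5 * n)) := by
      rw [gapSum_succ G hn]
      field_simp
      ring
    rw [hexp, Real.exp_add, mul_assoc]
    refine mul_le_mul_of_nonneg_left ?_ (Real.exp_nonneg _)
    rcases h.gap_succ n with e | e
    · simp [e]
    have hlen : (m : ℝ) + G n + 1 ≤ 5 * n := by
      have := h.gap_le_self n
      exact_mod_cast (by omega)
    have hfrac : ((m : ℝ) + G n + 1) / (5 * n) ≤ 1 := (div_le_one (by positivity)).2 hlen
    rw [e]
    push_cast
    rw [add_sub_cancel_left]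
    calc (m : ℝ) + G n ≤ (m + G n + 1) - (m + G n + 1) / (5 * n) := by linarith
      _ = (-(1 / (5 * n)) + 1) * (m + (G n + 1)) := by ring
      _ ≤ Real.exp (-(1 / (5 * n))) * (m + (G n + 1)) := by
        gcongr
        exact Real.add_one_le_exp _

theorem tendsto_div_zero (h : IsProfile p G)
    (hG : ¬ Summable fun n : ℕ => (G n : ℝ) / (n : ℝ) ^ 2) :
    Tendsto (fun m : ℕ => (p m : ℝ) / m) atTop (𝓝 0) := by
  have hexp : Tendsto (fun n => Real.exp (-gapSum G n / 5)) atTop (𝓝 0) :=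
    Real.tendsto_exp_atBot.comp
      ((tendsto_neg_atTop_atBot.comp (h.tendsto_gapSum hG)).atBot_div_const (by norm_num))
  refine tendsto_order.2 ⟨fun a ha => Eventually.of_forall fun m => ha.trans_le (by positivity),
    fun ε hε => ?_⟩
  obtain ⟨n, hn1, hn⟩ := ((eventually_ge_atTop 1).and
    (hexp.eventually_lt_const (half_pos hε))).exists
  filter_upwards [eventually_ge_atTop (max 1 (G n))] with m hm
  obtain ⟨hm1, hmG⟩ := max_le_iff.1 hm
  have hm0 : (0 : ℝ) < m := by exact_mod_cast hm1
  have hmG' : (G n : ℝ) ≤ m := by exact_mod_cast hmG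
  rw [div_lt_iff₀ hm0]
  calc (p m : ℝ) ≤ Real.exp (-gapSum G n / 5) * (m + G n) := h.le_exp_gapSum hn1 m
    _ ≤ Real.exp (-gapSum G n / 5) * (2 * m) := by gcongr; linarith
    _ < ε / 2 * (2 * m) := by gcongr
    _ = ε * m := by ring

end IsProfile

/-! ### Admissible sets and blocks -/

/-- A set of integers is admissible for `p` if each window of length `m` holds at most `p m` of its
points. A window is given by the finite set `F` of points that are counted in it. -/
def Admissible (p : ℕ → ℕ) (S : Set ℤ) : Prop :=
  ∀ (F : Finset ℤ) (m : ℕ), ↑F ⊆ S → (∀ s ∈ F, ∀ t ∈ F, s - t < m) → F.card ≤ p m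

namespace Admissible

variable {p : ℕ → ℕ} {S T : Set ℤ}

theorem subset (hT : Admissible p T) (h : S ⊆ T) : Admissible p S :=
  fun F m hF => hT F m (hF.trans h)

theorem of_subsingleton (hp : 1 ≤ p 1) (hmono : Monotone p) (hS : S.Subsingleton) :
    Admissible p S := by
  intro F m hF hm
  rcases F.eq_empty_or_nonempty with rfl | ⟨s, hs⟩
  · simp
  have hm1 : 1 ≤ m := by
    have := hm s hs s hs
    omega
  exact (Finset.card_le_one.2 fun s hs t ht => hS (hF hs) (hF ht)).trans (hp.trans (hmono hm1))

theorem translate (hS : Admissible p S) (v : ℤ) : Admissible p {t | t + v ∈ S} := by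
  intro F m hF hm
  rw [← Finset.card_image_of_injective F (add_left_injective v)]
  refine hS _ m ?_ ?_
  · rw [Finset.coe_image]
    exact Set.image_subset_iff.2 hF
  · simpa only [Finset.forall_mem_image, add_sub_add_right_eq_sub] using hm

theorem card_add_card_le {n c m : ℕ} (hmono : Monotone p)
    (hglue : ∀ a b, a ≤ n → b ≤ n → p a + p b ≤ p (a + b + c)) {L R : Finset ℤ}
    (hL : Admissible p L) (hR : Admissible p R) (neL : L.Nonempty) (neR : R.Nonempty)
    (dL : ∀ s ∈ L, ∀ t ∈ L, s - t < n) (dR : ∀ s ∈ R, ∀ t ∈ R, s - t < n)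
    (hgap : ∀ s ∈ L, ∀ t ∈ R, (c : ℤ) < t - s) (hm : ∀ s ∈ L, ∀ t ∈ R, t - s < m) :
    L.card + R.card ≤ p m := by
  have window : ∀ (F : Finset ℤ) (ne : F.Nonempty), Admissible p F →
      F.card ≤ p (F.max' ne - F.min' ne + 1).toNat := by
    intro F ne hF
    refine hF F _ subset_rfl fun s hs t ht => ?_
    have := F.le_max' s hs
    have := F.min'_le t ht
    omega
  have hLspan := dL _ (L.max'_mem neL) _ (L.min'_mem neL)
  have hRspan := dR _ (R.max'_mem neR) _ (R.min'_mem neR)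
  have hLR := hgap _ (L.max'_mem neL) _ (R.min'_mem neR)
  have htotal := hm _ (L.min'_mem neL) _ (R.max'_mem neR)
  have hLmin := L.min'_le _ (L.max'_mem neL)
  have hRmin := R.min'_le _ (R.max'_mem neR)
  calc L.card + R.card ≤ _ := add_le_add (window L neL hL) (window R neR hR)
    _ ≤ _ := hglue _ _ (by omega) (by omega)
    _ ≤ p m := hmono (by omega)

/-- The step of the induction in `union`: the points of `S` and `T` may be interleaved, but on the
right of the last point `s` of `S` there are only points of `T`. -/
theorem card_le_of_last {n c m : ℕ} (hmono : Monotone p)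
    (hglue : ∀ a b, a ≤ n → b ≤ n → p a + p b ≤ p (a + b + c)) (hT : Admissible p T)
    (dS : ∀ s ∈ S, ∀ t ∈ S, s - t < n) (dT : ∀ s ∈ T, ∀ t ∈ T, s - t < n)
    (hgap : ∀ s ∈ S, ∀ t ∈ T, (c : ℤ) < |s - t|) {F : Finset ℤ} (hF : ↑F ⊆ S ∪ T)
    (hm : ∀ s ∈ F, ∀ t ∈ F, s - t < m) {s u : ℤ} (hs : s ∈ F) (hsS : s ∈ S)
    (hsmax : ∀ t ∈ F, t ∈ S → t ≤ s) (hu : u ∈ F) (huT : u ∈ T) (hsu : s < u)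
    (hL : Admissible p (F.filter (· ≤ s) : Finset ℤ)) : F.card ≤ p m := by
  have mem_L : ∀ t ∈ F.filter (· ≤ s), t ∈ F ∧ t ≤ s := fun t ht => Finset.mem_filter.1 ht
  have mem_R : ∀ t ∈ F.filter (¬ · ≤ s), t ∈ F ∧ s < t ∧ t ∈ T := fun t ht => by
    obtain ⟨htF, hst⟩ := Finset.mem_filter.1 ht
    exact ⟨htF, not_le.1 hst, (hF htF).resolve_left fun htS => hst (hsmax t htF htS)⟩
  rw [← Finset.card_filter_add_card_filter_not (· ≤ s)]
  refine card_add_card_le hmono hglue hL (hT.subset fun t ht => (mem_R t ht).2.2)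
    ⟨s, Finset.mem_filter.2 ⟨hs, le_rfl⟩⟩ ⟨u, Finset.mem_filter.2 ⟨hu, not_le.2 hsu⟩⟩
    (fun t ht t' ht' => ?_) (fun t ht t' ht' => dT t (mem_R t ht).2.2 t' (mem_R t' ht').2.2)
    (fun t ht t' ht' => ?_) (fun t ht t' ht' => hm t' (mem_R t' ht').1 t (mem_L t ht).1)
  · have hts := (mem_L t ht).2
    rcases hF (mem_L t' ht').1 with h | h
    · have := dS s hsS t' h
      omega
    · have := dT u huT t' h
      omega
  · have hts := (mem_L t ht).2
    obtain ⟨-, hst', ht'T⟩ := mem_R t' ht'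
    have := hgap s hsS t' ht'T
    rw [abs_sub_comm, abs_of_pos (by omega)] at this
    omega

theorem union {n c : ℕ} (hmono : Monotone p)
    (hglue : ∀ a b, a ≤ n → b ≤ n → p a + p b ≤ p (a + b + c))
    (hS : Admissible p S) (hT : Admissible p T) (dS : ∀ s ∈ S, ∀ t ∈ S, s - t < n)
    (dT : ∀ s ∈ T, ∀ t ∈ T, s - t < n) (hgap : ∀ s ∈ S, ∀ t ∈ T, (c : ℤ) < |s - t|) :
    Admissible p (S ∪ T) := by
  classical
  intro F
  induction F using Finset.strongInduction generalizing S T with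
  | H F ih =>
  intro m hF hm
  by_cases hFS : ↑F ⊆ S
  · exact hS F m hFS hm
  by_cases hFT : ↑F ⊆ T
  · exact hT F m hFT hm
  have hF0 : F.Nonempty := Finset.nonempty_iff_ne_empty.2 fun h => hFS (by simp [h])
  wlog hmax : F.max' hF0 ∈ T generalizing S T
  · refine this hT hS dT dS (fun s hs t ht => ?_) (by rwa [Set.union_comm]) hFT hFS
      ((hF (F.max'_mem hF0)).resolve_right hmax)
    rw [abs_sub_comm]
    exact hgap t ht s hs
  obtain ⟨s, hs, hsmax⟩ := (F.filter (· ∈ S)).exists_max_image id (by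
    obtain ⟨t, htF, htT⟩ := Set.not_subset.1 hFT
    exact ⟨t, Finset.mem_filter.2 ⟨htF, (hF htF).resolve_right htT⟩⟩)
  obtain ⟨hsF, hsS⟩ := Finset.mem_filter.1 hs
  have hs_lt : s < F.max' hF0 := (F.le_max' s hsF).lt_of_ne fun e => by
    simpa [← e, not_lt_of_ge] using hgap s hsS _ hmax
  have hLF : F.filter (· ≤ s) ⊂ F :=
    Finset.filter_ssubset.2 ⟨_, F.max'_mem hF0, not_le.2 hs_lt⟩
  refine card_le_of_last hmono hglue hT dS dT hgap hF hm hsF hsS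
    (fun t ht htS => hsmax t (Finset.mem_filter.2 ⟨ht, htS⟩)) (F.max'_mem hF0) hmax hs_lt
    fun F' m' hF' => ?_
  have hF'L := Finset.coe_subset.1 hF'
  exact ih F' (hF'L.trans_ssubset hLF) hS hT dS dT hgap m'
    ((Finset.coe_subset.2 (hF'L.trans hLF.subset)).trans hF)

end Admissible

/-- The sequences over `{0, …, K}` that vanish outside of `[0, n)` and whose nonzero symbols stand
at the points of an admissible set. -/
def blocks (p : ℕ → ℕ) (K n : ℕ) : Set (ℤ → Fin (K + 1)) :=
  {x | Admissible p {t | x t ≠ 0} ∧ ∀ t, x t ≠ 0 → 0 ≤ t ∧ t < n}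

/-- The sequence that carries `x` on the left of `a` and `y`, moved right by `a + c`, on the right
of `a`. -/
def joinBlocks {K : ℕ} (a c : ℕ) (x y : ℤ → Fin (K + 1)) : ℤ → Fin (K + 1) :=
  fun t => if t < a then x t else y (t + -(a + c))

section blocks

variable {p : ℕ → ℕ} {K : ℕ}

theorem eq_zero_of_mem_blocks {n : ℕ} {x : ℤ → Fin (K + 1)} (hx : x ∈ blocks p K n) {t : ℤ}
    (ht : ¬ (0 ≤ t ∧ t < n)) : x t = 0 :=
  not_not.1 fun h => ht (hx.2 t h)

theorem blocks_injOn (n : ℕ) :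
    Set.InjOn (fun (x : ℤ → Fin (K + 1)) (i : Fin n) => x (i : ℕ)) (blocks p K n) := by
  intro x hx y hy h
  funext t
  by_cases ht : 0 ≤ t ∧ t < n
  · simpa [Int.toNat_of_nonneg ht.1] using congrFun h ⟨t.toNat, by omega⟩
  · rw [eq_zero_of_mem_blocks hx ht, eq_zero_of_mem_blocks hy ht]

theorem blocks_finite (n : ℕ) : (blocks p K n).Finite :=
  Set.Finite.of_injOn (Set.mapsTo_univ _ _) (blocks_injOn n) Set.finite_univ

theorem ncard_blocks_pos (n : ℕ) : 0 < (blocks p K n).ncard := by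
  refine (Set.ncard_pos (blocks_finite n)).2 ⟨0, fun F m hF _ => ?_, by simp⟩
  have : F = ∅ := by simpa using hF
  simp [this]

theorem ncard_blocks_add_le (m n : ℕ) :
    (blocks p K (m + n)).ncard ≤ (blocks p K m).ncard * (blocks p K n).ncard := by
  rw [← Set.ncard_prod]
  refine Set.ncard_le_ncard_of_injOn (fun x => (fun t => if t < m then x t else 0,
    fun t => if 0 ≤ t then x (t + m) else 0)) ?_ ?_ ((blocks_finite m).prod (blocks_finite n))
  · refine fun x hx => ⟨⟨hx.1.subset fun t ht => ?_, fun t ht => ?_⟩,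
      (hx.1.translate m).subset fun t ht => ?_, fun t ht => ?_⟩
    · exact fun h => ht (by simp [h])
    · obtain ⟨hlt, hne⟩ := by simpa only [ne_eq, ite_eq_right_iff, Classical.not_imp] using ht
      exact ⟨(hx.2 t hne).1, hlt⟩
    · exact fun h => ht (by simp [h])
    · obtain ⟨hle, hne⟩ := by simpa only [ne_eq, ite_eq_right_iff, Classical.not_imp] using ht
      have := hx.2 _ hne
      push_cast at this
      exact ⟨hle, by omega⟩
  · intro x _ y _ h
    obtain ⟨hleft, hright⟩ := Prod.mk.inj h
    funext t
    by_cases ht : t < m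
    · simpa [ht] using congrFun hleft t
    · simpa [not_lt.1 ht] using congrFun hright (t - m)

theorem joinBlocks_mem_blocks (hmono : Monotone p) {c : ℕ}
    (hglue : ∀ a b, p a + p b ≤ p (a + b + c)) {a b : ℕ} {x y : ℤ → Fin (K + 1)}
    (hx : x ∈ blocks p K a) (hy : y ∈ blocks p K b) :
    joinBlocks a c x y ∈ blocks p K (a + b + c) := by
  have hsupp : ∀ t, joinBlocks a c x y t ≠ 0 → x t ≠ 0 ∨ y (t + -(a + c)) ≠ 0 := by
    intro t ht
    by_cases h : t < a <;> simp only [joinBlocks, h, if_true, if_false] at ht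
    exacts [Or.inl ht, Or.inr ht]
  constructor
  · refine (Admissible.union hmono (n := max a b) (fun a b _ _ => hglue a b) hx.1
      (hy.1.translate (-(a + c))) (fun s hs t ht => ?_) (fun s hs t ht => ?_)
      fun s hs t ht => ?_).subset hsupp
    · have := hx.2 s hs
      have := hx.2 t ht
      omega
    · have := hy.2 _ hs
      have := hy.2 _ ht
      omega
    · have := hx.2 s hs
      have := hy.2 _ ht
      rw [abs_sub_comm, abs_of_nonneg (by omega)]
      omega
  · intro t ht
    push_cast
    rcases hsupp t ht with h | h
    · have := hx.2 t h
      omega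
    · have := hy.2 _ h
      omega

theorem ncard_blocks_mul_le (hmono : Monotone p) {c : ℕ}
    (hglue : ∀ a b, p a + p b ≤ p (a + b + c)) (a b : ℕ) :
    (blocks p K a).ncard * (blocks p K b).ncard ≤ (blocks p K (a + b + c)).ncard := by
  rw [← Set.ncard_prod]
  refine Set.ncard_le_ncard_of_injOn (fun z => joinBlocks a c z.1 z.2)
    (fun z hz => joinBlocks_mem_blocks hmono hglue hz.1 hz.2) ?_ (blocks_finite _)
  rintro ⟨x, y⟩ ⟨hx, hy⟩ ⟨x', y'⟩ ⟨hx', hy'⟩ h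
  refine Prod.ext (funext fun t => ?_) (funext fun t => ?_)
  · by_cases ht : t < a
    · simpa [joinBlocks, ht] using congrFun h t
    · exact (eq_zero_of_mem_blocks hx (by omega)).trans (eq_zero_of_mem_blocks hx' (by omega)).symm
  · by_cases ht : 0 ≤ t
    · simpa [joinBlocks, show ¬ t + (a + c) < a by omega, -neg_add_rev]
        using congrFun h (t + (a + c))
    · exact (eq_zero_of_mem_blocks hy (by omega)).trans (eq_zero_of_mem_blocks hy' (by omega)).symm

theorem ncard_blocks_pow_le (hmono : Monotone p) {c : ℕ}
    (hglue : ∀ a b, p a + p b ≤ p (a + b + c)) (n q : ℕ) :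
    (blocks p K n).ncard ^ q ≤ (blocks p K (q * (n + c))).ncard := by
  induction q with
  | zero => simpa using Nat.succ_le_of_lt (ncard_blocks_pos (p := p) (K := K) 0)
  | succ q ih =>
    rw [pow_succ]
    refine (Nat.mul_le_mul_right _ ih).trans ((ncard_blocks_mul_le hmono hglue _ _).trans_eq ?_)
    rw [add_assoc, ← Nat.succ_mul]

theorem le_ncard_blocks_one (hp : 1 ≤ p 1) (hmono : Monotone p) :
    K + 1 ≤ (blocks p K 1).ncard := by
  calc K + 1 = (Set.univ : Set (Fin (K + 1))).ncard := by simp [Set.ncard_univ]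
    _ ≤ (blocks p K 1).ncard :=
      Set.ncard_le_ncard_of_injOn (Pi.single (M := fun _ => Fin (K + 1)) 0) (fun a _ => ?_)
        (Pi.single_injective _).injOn (blocks_finite _)
  have hsupp : ∀ t : ℤ, (Pi.single 0 a : ℤ → Fin (K + 1)) t ≠ 0 → t = 0 :=
    fun t ht => not_not.1 fun h => ht (by simp [h])
  exact ⟨.of_subsingleton hp hmono fun s hs t ht => (hsupp s hs).trans (hsupp t ht).symm,
    fun t ht => by simp [hsupp t ht]⟩

/-- A Chernoff bound: weigh a word by `t` to the number of its nonzero symbols. -/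
theorem card_few_ne_zero_mul_pow_le {t : ℝ} (ht0 : 0 ≤ t) (ht1 : t ≤ 1) (n r : ℕ) :
    (Finset.card {w : Fin n → Fin (K + 1) | Finset.card {i | w i ≠ 0} ≤ r} : ℝ) * t ^ r
      ≤ (1 + K * t) ^ n := by
  have hweight : ∀ w : Fin n → Fin (K + 1),
      ∏ i, (if w i ≠ 0 then t else 1) = t ^ Finset.card {i | w i ≠ 0} := fun w => by
    rw [Finset.prod_ite, Finset.prod_const, Finset.prod_const_one, mul_one]
  calc _ = ∑ w : Fin n → Fin (K + 1) with Finset.card {i | w i ≠ 0} ≤ r, t ^ r := by simp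
    _ ≤ ∑ w : Fin n → Fin (K + 1) with Finset.card {i | w i ≠ 0} ≤ r,
        ∏ i, (if w i ≠ 0 then t else 1) := Finset.sum_le_sum fun w hw => by
      rw [hweight]
      exact pow_le_pow_of_le_one ht0 ht1 (Finset.mem_filter.1 hw).2
    _ ≤ ∑ w : Fin n → Fin (K + 1), ∏ i, (if w i ≠ 0 then t else 1) :=
      Finset.sum_le_sum_of_subset_of_nonneg (Finset.filter_subset _ _) fun w _ _ => by
        rw [hweight]
        positivity
    _ = (1 + K * t) ^ n := by
      rw [← Fintype.sum_pow (fun a : Fin (K + 1) => if a ≠ 0 then t else 1), Fin.sum_univ_succ]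
      simp [Fin.succ_ne_zero]

theorem ncard_blocks_le_card (n : ℕ) : (blocks p K n).ncard ≤
    Finset.card {w : Fin n → Fin (K + 1) | Finset.card {i | w i ≠ 0} ≤ p n} := by
  rw [← Set.ncard_coe_finset]
  refine Set.ncard_le_ncard_of_injOn _ (fun x hx => ?_) (blocks_injOn n) (Finset.finite_toSet _)
  rw [Finset.mem_coe, Finset.mem_filter_univ, ← Finset.card_image_of_injective
    (f := fun i : Fin n => ((i : ℕ) : ℤ)) _ (fun i j h => by simpa [Fin.ext_iff] using h)]
  refine hx.1 _ n ?_ ?_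
  · rw [Finset.coe_image, Set.image_subset_iff]
    exact fun i hi => (Finset.mem_filter.1 hi).2
  · simp only [Finset.forall_mem_image]
    omega

end blocks

/-! ### The entropy of the blocks -/

/-- The binary logarithm of the number of blocks of length `n`, that is, their entropy in bits. -/
noncomputable def logBlocks (p : ℕ → ℕ) (K n : ℕ) : ℝ :=
  Real.logb 2 ((blocks p K n).ncard : ℝ)

section logBlocks

variable {p : ℕ → ℕ} {K : ℕ}

theorem logBlocks_nonneg (n : ℕ) : 0 ≤ logBlocks p K n :=
  Real.logb_nonneg one_lt_two (by exact_mod_cast ncard_blocks_pos n)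

theorem subadditive_logBlocks : Subadditive (logBlocks p K) := by
  have hpos : ∀ n, (0 : ℝ) < (blocks p K n).ncard := fun n => by exact_mod_cast ncard_blocks_pos n
  intro m n
  rw [logBlocks, logBlocks, logBlocks, ← Real.logb_mul (hpos m).ne' (hpos n).ne']
  exact Real.logb_le_logb_of_le one_lt_two (hpos _) (by exact_mod_cast ncard_blocks_add_le m n)

theorem bddBelow_logBlocks_div : BddBelow (Set.range fun n => logBlocks p K n / n) :=
  ⟨0, Set.forall_mem_range.2 fun n => div_nonneg (logBlocks_nonneg n) n.cast_nonneg⟩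

/-- The exponential growth rate of the number of blocks of length `n`. -/
noncomputable def blockEntropy (p : ℕ → ℕ) (K : ℕ) : ℝ :=
  (subadditive_logBlocks (p := p) (K := K)).lim

theorem tendsto_logBlocks_div :
    Tendsto (fun n => logBlocks p K n / n) atTop (𝓝 (blockEntropy p K)) :=
  subadditive_logBlocks.tendsto_lim bddBelow_logBlocks_div

theorem blockEntropy_le_logBlocks_div {n : ℕ} (hn : n ≠ 0) :
    blockEntropy p K ≤ logBlocks p K n / n :=
  subadditive_logBlocks.lim_le_div bddBelow_logBlocks_div hn

theorem logBlocks_div_le_blockEntropy (hmono : Monotone p) {c : ℕ}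
    (hglue : ∀ a b, p a + p b ≤ p (a + b + c)) {n : ℕ} (hn : n ≠ 0) :
    logBlocks p K n / (n + c) ≤ blockEntropy p K := by
  have hnc : 0 < n + c := by omega
  have hsub : Tendsto (fun q : ℕ => q * (n + c)) atTop atTop := tendsto_id.atTop_mul_const' hnc
  refine ge_of_tendsto (tendsto_logBlocks_div.comp hsub) ?_
  filter_upwards [eventually_gt_atTop 0] with q hq
  have hq0 : (0 : ℝ) < q := by exact_mod_cast hq
  have hpos : (0 : ℝ) < (blocks p K n).ncard := by exact_mod_cast ncard_blocks_pos n
  have hpow : q * logBlocks p K n ≤ logBlocks p K (q * (n + c)) := by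
    rw [logBlocks, ← Real.logb_pow]
    exact Real.logb_le_logb_of_le one_lt_two (by positivity)
      (by exact_mod_cast ncard_blocks_pow_le hmono hglue n q)
  calc logBlocks p K n / (n + c) = q * logBlocks p K n / (q * (n + c)) :=
        (mul_div_mul_left _ _ hq0.ne').symm
    _ ≤ logBlocks p K (q * (n + c)) / (q * (n + c)) := by gcongr
    _ = _ := by simp only [Function.comp_apply, Nat.cast_mul, Nat.cast_add]

theorem blockEntropy_le_logb (h0 : Tendsto (fun m : ℕ => (p m : ℝ) / m) atTop (𝓝 0)) {t : ℝ}
    (ht0 : 0 < t) (ht1 : t ≤ 1) : blockEntropy p K ≤ Real.logb 2 (1 + K * t) := by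
  have hlim := tendsto_const_nhds (x := Real.logb 2 (1 + K * t)).sub (h0.mul_const (Real.logb 2 t))
  rw [zero_mul, sub_zero] at hlim
  refine le_of_tendsto_of_tendsto tendsto_logBlocks_div hlim ?_
  filter_upwards [eventually_gt_atTop 0] with n hn
  have hn0 : (0 : ℝ) < n := by exact_mod_cast hn
  have hpos : (0 : ℝ) < (blocks p K n).ncard := by exact_mod_cast ncard_blocks_pos n
  have hcount : ((blocks p K n).ncard : ℝ) * t ^ p n ≤ (1 + K * t) ^ n := by
    refine le_trans ?_ (card_few_ne_zero_mul_pow_le ht0.le ht1 n (p n))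
    gcongr
    exact ncard_blocks_le_card n
  have hlog := Real.logb_le_logb_of_le one_lt_two (by positivity) hcount
  rw [Real.logb_mul hpos.ne' (by positivity), Real.logb_pow, Real.logb_pow] at hlog
  rw [div_le_iff₀ hn0, sub_mul, div_mul_eq_mul_div, div_mul_cancel₀ _ hn0.ne', logBlocks]
  linarith

theorem blockEntropy_eq_zero (h0 : Tendsto (fun m : ℕ => (p m : ℝ) / m) atTop (𝓝 0)) :
    blockEntropy p K = 0 := by
  refine le_antisymm ?_ (ge_of_tendsto' tendsto_logBlocks_div fun n =>
    div_nonneg (logBlocks_nonneg n) n.cast_nonneg)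
  have hcont : ContinuousAt (fun t : ℝ => Real.logb 2 (1 + K * t)) 0 :=
    (ContinuousAt.log (by fun_prop) (by simp)).div_const _
  have hlim : Tendsto (fun t : ℝ => Real.logb 2 (1 + K * t)) (𝓝[>] 0) (𝓝 0) := by
    simpa using hcont.tendsto.mono_left nhdsWithin_le_nhds
  refine ge_of_tendsto hlim ?_
  filter_upwards [Ioc_mem_nhdsGT (zero_lt_one' ℝ)] with t ht
  exact blockEntropy_le_logb h0 ht.1 ht.2

end logBlocks

/-- The gap function `G` follows the rule of growing, within the bound given by `f`, exactly while
the blocks of the current length stay numerous compared to one of the first terms of `a`. -/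
def FollowsRule (f : ℕ → ℕ) (a : ℕ → ℝ) (K : ℕ) (p G : ℕ → ℕ) : Prop :=
  ∀ n, 1 ≤ n → (G (n + 1) = G n + 1 ↔
    G n + 1 ≤ f n ∧ ∃ i ≤ n, a i * (n + G n + 1) < logBlocks p K n)

namespace IsProfile

variable {f p G : ℕ → ℕ} {a : ℕ → ℝ} {K : ℕ} {α : ℝ}

theorem gap_succ_le (h : IsProfile p G) (hrule : FollowsRule f a K p G) (hf : Monotone f) (n : ℕ) :
    G (n + 1) ≤ f n := by
  induction n with
  | zero => exact h.gap_one.trans_le (Nat.zero_le _)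
  | succ n ih =>
    rcases h.gap_succ (n + 1) with e | e
    · exact e.trans_le (ih.trans (hf n.le_succ))
    · exact e.trans_le ((hrule _ n.succ_pos).1 e).1

theorem exists_gap_succ (h : IsProfile p G) {N m : ℕ} (hlt : G N < G m) :
    ∃ n ≥ N, G (n + 1) = G n + 1 ∧ G m = G n + 1 := by
  induction m with
  | zero => exact absurd (h.gap_mono N.zero_le) hlt.not_ge
  | succ m ih =>
    rcases h.gap_succ m with e | e
    · rw [e] at hlt ⊢
      exact ih hlt
    · exact ⟨m, not_lt.1 fun hmN => hlt.not_ge (h.gap_mono hmN), e, e⟩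

theorem le_logBlocks_of_gap_succ (hrule : FollowsRule f a K p G)
    (ha : α ∈ lowerBounds (Set.range a)) {n : ℕ} (hn : 1 ≤ n) (hG : G (n + 1) = G n + 1) :
    α * (n + G n + 1) ≤ logBlocks p K n := by
  obtain ⟨-, i, -, hi⟩ := (hrule n hn).1 hG
  refine le_trans ?_ hi.le
  gcongr
  exact ha ⟨i, rfl⟩

theorem le_blockEntropy_of_bddAbove (h : IsProfile p G) (hrule : FollowsRule f a K p G)
    (hK : α ≤ Real.logb 2 (K + 1)) (ha : α ∈ lowerBounds (Set.range a))
    (hG : BddAbove (Set.range G)) : α ≤ blockEntropy p K := by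
  obtain ⟨M, hM⟩ : ∃ M, ∀ m, G m ≤ G M := by
    obtain ⟨M, hM⟩ := Nat.sSup_mem (Set.range_nonempty G) hG
    exact ⟨M, fun m => (le_csSup hG ⟨m, rfl⟩).trans_eq hM.symm⟩
  obtain ⟨n, hn, hle⟩ : ∃ n ≥ 1, α * (n + G M) ≤ logBlocks p K n := by
    rcases (G M).eq_zero_or_pos with h0 | hpos
    · refine ⟨1, le_rfl, ?_⟩
      have hcount : (K : ℝ) + 1 ≤ (blocks p K 1).ncard := by
        exact_mod_cast le_ncard_blocks_one h.one.ge h.mono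
      have hlog := Real.logb_le_logb_of_le one_lt_two (by positivity) hcount
      simpa [h0, logBlocks] using hK.trans hlog
    · obtain ⟨n, hn, hsucc, hMn⟩ := h.exists_gap_succ (h.gap_one.trans_lt hpos)
      refine ⟨n, hn, ?_⟩
      simpa [hMn, add_assoc] using le_logBlocks_of_gap_succ hrule ha hn hsucc
  have hn0 : n ≠ 0 := by omega
  refine le_trans ?_ (logBlocks_div_le_blockEntropy h.mono (c := G M) (fun a b =>
    h.glue_of_le (hM (max a b)) (le_max_left _ _) (le_max_right _ _)) hn0)
  rwa [le_div_iff₀ (by positivity)]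

theorem le_blockEntropy (h : IsProfile p G) (hrule : FollowsRule f a K p G) (hα : 0 ≤ α)
    (hK : α ≤ Real.logb 2 (K + 1)) (ha : α ∈ lowerBounds (Set.range a)) :
    α ≤ blockEntropy p K := by
  by_cases hG : BddAbove (Set.range G)
  · exact h.le_blockEntropy_of_bddAbove hrule hK ha hG
  refine ge_of_tendsto_of_frequently tendsto_logBlocks_div (frequently_atTop.2 fun N => ?_)
  obtain ⟨_, ⟨m, rfl⟩, hm⟩ := not_bddAbove_iff.1 hG (G (N + 1))
  obtain ⟨n, hn, hsucc, -⟩ := h.exists_gap_succ hm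
  have hn0 : (0 : ℝ) < n := by exact_mod_cast (by omega : 0 < n)
  refine ⟨n, by omega, (le_div_iff₀ hn0).2 ?_⟩
  refine le_trans ?_ (le_logBlocks_of_gap_succ hrule ha (by omega) hsucc)
  gcongr
  linarith [(G n).cast_nonneg (α := ℝ)]

theorem eventually_mul_lt_logBlocks (hα : α < blockEntropy p K) (ha : IsGLB (Set.range a) α)
    (hG : Tendsto (fun n : ℕ => (G n : ℝ) / n) atTop (𝓝 0)) :
    ∀ᶠ n in atTop, ∃ i ≤ n, a i * (n + G n + 1) < logBlocks p K n := by
  obtain ⟨_, ⟨i, rfl⟩, hi⟩ := (isGLB_lt_iff ha).1 hα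
  have hlim : Tendsto (fun n : ℕ => a i * (1 + (G n : ℝ) / n + 1 / n)) atTop (𝓝 (a i)) := by
    simpa using ((hG.const_add 1).add tendsto_one_div_atTop_nhds_zero_nat).const_mul (a i)
  filter_upwards [hlim.eventually_lt_const hi, eventually_ge_atTop (max i 1)] with n hn hmax
  obtain ⟨hin, hn1⟩ := max_le_iff.1 hmax
  have hn0 : (0 : ℝ) < n := by exact_mod_cast hn1
  refine ⟨i, hin, ?_⟩
  calc a i * (n + G n + 1) = a i * (1 + (G n : ℝ) / n + 1 / n) * n := by field_simp
    _ < blockEntropy p K * n := by gcongr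
    _ ≤ logBlocks p K n := (le_div_iff₀ hn0).1 (blockEntropy_le_logBlocks_div (by omega))

theorem min_le_gap_add (h : IsProfile p G) (hrule : FollowsRule f a K p G) (hf : Monotone f)
    {n : ℕ} (hn : 1 ≤ n) (htest : ∀ m ≥ n, ∃ i ≤ m, a i * (m + G m + 1) < logBlocks p K m) (k : ℕ) :
    min (f n) k ≤ G (n + k) := by
  induction k with
  | zero => simp
  | succ k ih =>
    have hGmono : G (n + k) ≤ G (n + k + 1) := h.gap_mono (Nat.le_succ _)
    have hfmono : f n ≤ f (n + k) := hf (Nat.le_add_right _ _)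
    rw [← add_assoc]
    by_cases hle : G (n + k) + 1 ≤ f (n + k)
    · have := (hrule _ (by omega)).2 ⟨hle, htest _ (by omega)⟩
      omega
    · omega

/-- If the number of blocks stayed too large, either the series of `G n / n²` would diverge, which
brings the density of the blocks to zero, or `G` would catch up with `f`, whose series diverges. -/
theorem blockEntropy_le (h : IsProfile p G) (hrule : FollowsRule f a K p G) (hα : 0 ≤ α)
    (ha : IsGLB (Set.range a) α) (hf : Monotone f)
    (hsum : ¬ Summable fun n : ℕ => (f n : ℝ) / (n : ℝ) ^ 2) : blockEntropy p K ≤ α := by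
  by_contra! hlt
  have hsumG : Summable fun n : ℕ => (G n : ℝ) / (n : ℝ) ^ 2 := by
    by_contra hG
    exact hα.not_gt (blockEntropy_eq_zero (K := K) (h.tendsto_div_zero hG) ▸ hlt)
  have hG : Tendsto (fun n : ℕ => (G n : ℝ) / n) atTop (𝓝 0) :=
    tendsto_div_zero_of_summable_div_sq (g := fun n => G n) (Nat.mono_cast.comp h.gap_mono)
      (fun n => (G n).cast_nonneg) hsumG
  have hG2 : ∀ᶠ n in atTop, G (2 * n) < n := by
    have hdouble := hG.comp (tendsto_id.const_mul_atTop' (show 0 < 2 by norm_num))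
    filter_upwards [hdouble.eventually_lt_const (show (0 : ℝ) < 1 / 2 by norm_num),
      eventually_gt_atTop 0] with n hn hn0
    have : (0 : ℝ) < n := by exact_mod_cast hn0
    simp only [Function.comp_apply, id, Nat.cast_mul, Nat.cast_ofNat] at hn
    rw [div_lt_iff₀ (by positivity)] at hn
    exact_mod_cast (show (G (2 * n) : ℝ) < n by linarith)
  refine hsum (summable_div_sq_of_eventually_le hsumG ?_)
  filter_upwards [eventually_forall_ge_atTop.2 (eventually_mul_lt_logBlocks hlt ha hG), hG2,
    eventually_ge_atTop 1] with n htest hn hn1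
  have hmin := h.min_le_gap_add hrule hf hn1 htest n
  rw [← two_mul] at hmin
  omega

theorem blockEntropy_eq (h : IsProfile p G) (hrule : FollowsRule f a K p G) (hα : 0 ≤ α)
    (hK : α ≤ Real.logb 2 (K + 1)) (ha : IsGLB (Set.range a) α) (hf : Monotone f)
    (hsum : ¬ Summable fun n : ℕ => (f n : ℝ) / (n : ℝ) ^ 2) : blockEntropy p K = α :=
  le_antisymm (h.blockEntropy_le hrule hα ha hf hsum) (h.le_blockEntropy hrule hα hK ha.1)

end IsProfile

/-! ### The density shift -/

theorem isClosed_admissible {ι A : Type*} [Zero A] [TopologicalSpace A] [DiscreteTopology A]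
    (p : ℕ → ℕ) (g : ℤ → ι) : IsClosed {x : ι → A | Admissible p {t | x (g t) ≠ 0}} := by
  simp only [Admissible, Set.ofPred_forall]
  refine isClosed_iInter fun F => isClosed_iInter fun m =>
    isClosed_imp ?_ (isClosed_imp isOpen_const isClosed_const)
  have hcoord (t : ℤ) : IsOpen {x : ι → A | x (g t) ≠ 0} :=
    isOpen_ne_fun (continuous_apply (g t)) continuous_const
  simpa only [Set.subset_def, Set.ofPred_forall, Set.mem_ofPred_eq, Finset.mem_coe] using
    isOpen_biInter_finset fun t (_ : t ∈ F) => hcoord t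

/-- The configurations on `ℤ ^ (d + 1)` in which the nonzero symbols of each row in the first
direction form a set that is admissible for `p`. -/
def densityShift (d K : ℕ) (p : ℕ → ℕ) : ZSubshift (d + 1) (K + 1) where
  carrier := {x | ∀ r : Fin d → ℤ, Admissible p {t | x (Fin.cons t r) ≠ 0}}
  isClosed := by
    simp only [Set.ofPred_forall]
    exact isClosed_iInter fun r => isClosed_admissible p _
  mapsTo := by
    intro g x hx r
    refine ((hx (Fin.tail g + r)).translate (g 0)).subset fun t ht => ?_
    have hcons : Fin.cons (t + g 0) (Fin.tail g + r) = g + Fin.cons t r := by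
      funext i
      refine Fin.cases (add_comm _ _) (fun j => rfl) i
    simpa only [Set.mem_ofPred_eq, shift_apply, hcons] using ht

section densityShift

variable {d K : ℕ} {p : ℕ → ℕ}

theorem densityShift_nonempty : (densityShift d K p).carrier.Nonempty :=
  ⟨0, fun r F m hF _ => by simp [show F = ∅ by simpa using hF]⟩

theorem dist_cons_cons (r : Fin d → ℤ) (s t : ℤ) :
    dist (Fin.cons s r : Fin (d + 1) → ℤ) (Fin.cons t r : Fin (d + 1) → ℤ) = |s - t| := by
  simp [dist_pi_def, Fin.univ_succ, ← Int.cast_sub, Int.dist_eq]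

theorem isIrreducible_densityShift {f : ℕ → ℕ} (hmono : Monotone p)
    (hglue : ∀ n a b, a ≤ n + 1 → b ≤ n + 1 → p a + p b ≤ p (a + b + f n)) :
    IsIrreducible f (densityShift d K p) := by
  classical
  intro n U V hU hV hUV u ⟨x, hx, hxu⟩ v ⟨y, hy, hyv⟩
  have hdisj : ∀ i ∈ V, i ∉ U := fun i hV hU =>
    (hUV i hU i hV).not_ge (by rw [dist_self]; positivity)
  have span_lt : ∀ {W : Finset (Fin (d + 1) → ℤ)}, (∀ i ∈ W, ∀ j ∈ W, dist i j ≤ n) →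
      ∀ {r s t}, Fin.cons s r ∈ W → Fin.cons t r ∈ W → s - t < (n + 1 : ℕ) := by
    intro W hW r s t hs ht
    have hdist := hW _ hs _ ht
    rw [dist_cons_cons] at hdist
    have : |s - t| ≤ n := by exact_mod_cast hdist
    have := le_abs_self (s - t)
    omega
  refine ⟨fun i => if i ∈ U then x i else if i ∈ V then y i else 0, fun r => ?_,
    fun i => by simp [hxu], fun j => by simp [hdisj j.1 j.2, hyv]⟩
  refine (Admissible.union hmono (hglue n)
    (S := {t | x (Fin.cons t r) ≠ 0 ∧ Fin.cons t r ∈ U})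
    (T := {t | y (Fin.cons t r) ≠ 0 ∧ Fin.cons t r ∈ V})
    ((hx r).subset fun t ht => ht.1) ((hy r).subset fun t ht => ht.1)
    (fun s hs t ht => span_lt hU hs.2 ht.2) (fun s hs t ht => span_lt hV hs.2 ht.2)
    fun s hs t ht => ?_).subset fun t ht => ?_
  · have hdist := hUV _ hs.2 _ ht.2
    rw [dist_cons_cons] at hdist
    exact_mod_cast hdist
  · simp only [Set.mem_ofPred_eq, Set.mem_union] at ht ⊢
    split_ifs at ht with h1 h2
    exacts [Or.inl ⟨ht, h1⟩, Or.inr ⟨ht, h2⟩, absurd rfl ht]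

theorem mem_language_densityShift {w : List ((Fin (d + 1) → ℤ) × Fin (K + 1))} :
    w ∈ language (densityShift d K p) ↔
      (∀ a ∈ w, ∀ b ∈ w, a.1 = b.1 → a.2 = b.2) ∧
      ∀ r : Fin d → ℤ, Admissible p {t | ∃ a, a ≠ 0 ∧ (Fin.cons t r, a) ∈ w} := by
  classical
  rw [mem_language_iff]
  constructor
  · rintro ⟨x, hx, hw⟩
    refine ⟨fun a ha b hb e => by rw [← hw a ha, ← hw b hb, e], fun r => (hx r).subset ?_⟩
    rintro t ⟨a, ha, hmem⟩
    exact (hw _ hmem).trans_ne ha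
  · rintro ⟨hcons, hadm⟩
    refine ⟨fun i => if h : ∃ a, (i, a) ∈ w then h.choose else 0, fun r => (hadm r).subset ?_, ?_⟩
    · intro t ht
      simp only [Set.mem_ofPred_eq] at ht ⊢
      split_ifs at ht with h
      exacts [⟨_, ht, h.choose_spec⟩, absurd rfl ht]
    · intro a ha
      have h : ∃ b, (a.1, b) ∈ w := ⟨a.2, ha⟩
      simp only [h, dite_true]
      exact hcons _ h.choose_spec a ha rfl

theorem mem_box_succ {n : ℕ} {i : Fin (d + 1) → ℤ} : i ∈ box (d + 1) n ↔
    ∃ (t : ℤ) (r : Fin d → Fin n), (0 ≤ t ∧ t < n) ∧ (Fin.cons t fun j => ((r j : ℕ) : ℤ)) = i := by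
  simp only [box, Fintype.mem_piFinset, Fin.forall_fin_succ, Finset.mem_Ico]
  constructor
  · rintro ⟨h0, hsucc⟩
    refine ⟨i 0, fun j => ⟨(i j.succ).toNat, by have := hsucc j; omega⟩, h0, ?_⟩
    funext j
    exact Fin.cases rfl (fun j => Int.toNat_of_nonneg (hsucc j).1) j
  · rintro ⟨t, r, ht, rfl⟩
    exact ⟨ht, fun j => by simp⟩

/-- The configuration that carries the sequences `B r` in the rows over the cube `[0, n) ^ d` and
vanishes in all other rows. -/
def stack {n : ℕ} (B : (Fin d → Fin n) → ℤ → Fin (K + 1)) (i : Fin (d + 1) → ℤ) : Fin (K + 1) :=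
  if h : ∀ j : Fin d, 0 ≤ i j.succ ∧ i j.succ < n then
    B (fun j => ⟨(i j.succ).toNat, by have := h j; omega⟩) (i 0) else 0

theorem stack_cons {n : ℕ} (B : (Fin d → Fin n) → ℤ → Fin (K + 1)) (r : Fin d → Fin n) (t : ℤ) :
    stack B (Fin.cons t fun j => ((r j : ℕ) : ℤ)) = B r t := by
  simp [stack]

theorem stack_mem_densityShift {n : ℕ} {B : (Fin d → Fin n) → ℤ → Fin (K + 1)}
    (hB : ∀ r, Admissible p {t | B r t ≠ 0}) : stack B ∈ (densityShift d K p).carrier := by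
  intro r
  by_cases h : ∀ j : Fin d, 0 ≤ r j ∧ r j < n
  · simpa [stack, h] using hB fun j => ⟨(r j).toNat, by have := h j; omega⟩
  · intro F m hF _
    simp [show F = ∅ by simpa [stack, h] using hF]

theorem ncard_languageOn_box (n : ℕ) :
    (languageOn (densityShift d K p) (box (d + 1) n)).ncard = (blocks p K n).ncard ^ n ^ d := by
  have : Finite (blocks p K n) := blocks_finite n
  let Φ : ((Fin d → Fin n) → blocks p K n) → languageOn (densityShift d K p) (box (d + 1) n) :=
    fun B => ⟨fun i => stack (fun r => (B r).1) i, _,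
      stack_mem_densityShift fun r => (B r).2.1, fun _ => rfl⟩
  have hΦ : Function.Bijective Φ := by
    constructor
    · intro B B' h
      refine funext fun r => Subtype.ext (funext fun t => ?_)
      by_cases ht : 0 ≤ t ∧ t < n
      · have hbox := mem_box_succ.2 ⟨t, r, ht, rfl⟩
        simpa only [Φ, stack_cons] using congrFun (congrArg Subtype.val h) ⟨_, hbox⟩
      · rw [eq_zero_of_mem_blocks (B r).2 ht, eq_zero_of_mem_blocks (B' r).2 ht]
    · rintro ⟨u, x, hx, hxu⟩
      refine ⟨fun r => ⟨fun t => if 0 ≤ t ∧ t < n then x (Fin.cons t fun j => ((r j : ℕ) : ℤ))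
        else 0, (hx fun j => ((r j : ℕ) : ℤ)).subset fun t ht h => ht (by simp [h]),
        fun t ht => ?_⟩, ?_⟩
      · by_contra h
        exact ht (if_neg h)
      · refine Subtype.ext (funext fun ⟨i, hi⟩ => ?_)
        obtain ⟨t, r, ht, rfl⟩ := mem_box_succ.1 hi
        simp only [Φ, stack_cons, if_pos ht]
        exact hxu ⟨_, hi⟩
  rw [← Nat.card_coe_set_eq, ← Nat.card_congr (Equiv.ofBijective Φ hΦ), Nat.card_fun,
    Nat.card_fun, Nat.card_coe_set_eq, Nat.card_fin, Nat.card_fin]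

theorem hasEntropy_densityShift : HasEntropy (densityShift d K p) (blockEntropy p K) := by
  refine tendsto_logBlocks_div.congr' ?_
  filter_upwards [eventually_ne_atTop 0] with n hn
  have hn0 : (n : ℝ) ≠ 0 := Nat.cast_ne_zero.2 hn
  rw [ncard_languageOn_box, Nat.cast_pow, Real.logb_pow, logBlocks]
  push_cast
  field_simp
  ring

end densityShift

/-! ### Computability of block counts -/

section Primrec

variable {α β σ : Type*} [Primcodable α] [Primcodable β] [Primcodable σ]

theorem primrecPred_forall_mem {L : α → List β} {R : α → β → Prop} (hL : Primrec L)
    (hR : PrimrecRel R) : PrimrecPred fun a => ∀ b ∈ L a, R a b :=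
  (PrimrecRel.forall_mem_list hR.swap).comp hL Primrec.id

theorem primrecPred_exists_mem {L : α → List β} {R : α → β → Prop} (hL : Primrec L)
    (hR : PrimrecRel R) : PrimrecPred fun a => ∃ b ∈ L a, R a b :=
  (PrimrecRel.exists_mem_list hR.swap).comp hL Primrec.id

theorem primrecPred_forall_le {n : α → ℕ} {R : α → ℕ → Prop} (hn : Primrec n)
    (hR : PrimrecRel R) : PrimrecPred fun a => ∀ m ≤ n a, R a m :=
  (primrecPred_forall_mem (Primrec.list_range.comp (Primrec.succ.comp hn)) hR).of_eq fun a => by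
    simp only [List.mem_range, Nat.lt_succ_iff]

theorem primrecPred_exists_le {n : α → ℕ} {R : α → ℕ → Prop} (hn : Primrec n)
    (hR : PrimrecRel R) : PrimrecPred fun a => ∃ m ≤ n a, R a m :=
  (primrecPred_exists_mem (Primrec.list_range.comp (Primrec.succ.comp hn)) hR).of_eq fun a => by
    simp only [List.mem_range, Nat.lt_succ_iff]

theorem primrec_filter {L : α → List β} {R : α → β → Prop} [∀ a, DecidablePred (R a)]
    (hL : Primrec L) (hR : PrimrecRel R) : Primrec fun a => (L a).filter fun b => R a b := by
  let : DecidableRel fun b a => R a b := fun b a => inferInstanceAs (Decidable (R a b))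
  exact (PrimrecRel.listFilter (R := fun b a => R a b) hR.swap).comp hL Primrec.id

theorem primrec_count {n : α → ℕ} {R : α → ℕ → Prop} [∀ a, DecidablePred (R a)]
    (hn : Primrec n) (hR : PrimrecRel R) : Primrec fun a => Nat.count (R a) (n a) :=
  (Primrec.list_length.comp (primrec_filter (Primrec.list_range.comp hn) hR)).of_eq fun a =>
    (Nat.count_eq_card_filter_range (R a) (n a)).symm

theorem primrec_nat_pow : Primrec₂ ((· ^ ·) : ℕ → ℕ → ℕ) :=
  Primrec₂.unpaired'.1 Nat.Primrec.pow

theorem encode_int_ofNat (n : ℕ) : Encodable.encode (Int.ofNat n) = 2 * n := by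
  change Nat.bit false n = _
  simp [Nat.bit]

theorem encode_int_negSucc (n : ℕ) : Encodable.encode (Int.negSucc n) = 2 * n + 1 := by
  change Nat.bit true n = _
  simp [Nat.bit]

theorem primrec_int_natCast : Primrec ((↑) : ℕ → ℤ) :=
  Primrec.encode_iff.1 ((Primrec.nat_mul.comp (Primrec.const 2) Primrec.id).of_eq fun n =>
    (encode_int_ofNat n).symm)

theorem primrec_int_toNat : Primrec Int.toNat := by
  have h : Primrec fun z : ℤ => if Encodable.encode z % 2 = 0 then Encodable.encode z / 2 else 0 :=
    Primrec.ite (Primrec.eq.comp (Primrec.nat_mod.comp Primrec.encode (Primrec.const 2))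
      (Primrec.const 0)) (Primrec.nat_div.comp Primrec.encode (Primrec.const 2)) (Primrec.const 0)
  refine h.of_eq fun z => ?_
  rcases z with n | n
  · rw [encode_int_ofNat, if_pos (by omega), Int.ofNat_eq_natCast, Int.toNat_natCast]; omega
  · rw [encode_int_negSucc, if_neg (by omega)]; rfl

theorem primrec_int_neg_toNat : Primrec fun z : ℤ => (-z).toNat := by
  have h : Primrec fun z : ℤ =>
      if Encodable.encode z % 2 = 0 then 0 else Encodable.encode z / 2 + 1 :=
    Primrec.ite (Primrec.eq.comp (Primrec.nat_mod.comp Primrec.encode (Primrec.const 2))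
      (Primrec.const 0)) (Primrec.const 0)
      (Primrec.succ.comp (Primrec.nat_div.comp Primrec.encode (Primrec.const 2)))
  refine h.of_eq fun z => ?_
  rcases z with n | n
  · rw [encode_int_ofNat, if_pos (by omega), Int.ofNat_eq_natCast]; omega
  · rw [encode_int_negSucc, if_neg (by omega), Int.neg_negSucc, Int.toNat_natCast]; omega

theorem primrec_int_sub_toNat : Primrec₂ fun a b : ℤ => (a - b).toNat := by
  have h : Primrec₂ fun a b : ℤ => (a.toNat + (-b).toNat) - (b.toNat + (-a).toNat) :=
    Primrec.nat_sub.comp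
      (Primrec.nat_add.comp (primrec_int_toNat.comp Primrec.fst)
        (primrec_int_neg_toNat.comp Primrec.snd))
      (Primrec.nat_add.comp (primrec_int_toNat.comp Primrec.snd)
        (primrec_int_neg_toNat.comp Primrec.fst))
  exact h.of_eq fun a b => by omega

theorem primrecRel_int_add_mem :
    PrimrecRel fun (x : List ℤ × ℤ) (i : ℕ) => x.2 + (i : ℤ) ∈ x.1 := by
  have h : PrimrecRel fun (x : List ℤ × ℤ) (i : ℕ) =>
      ∃ c ∈ x.1, (c - x.2).toNat = i ∧ (x.2 - c).toNat = 0 := by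
    refine primrecPred_exists_mem (Primrec.fst.comp Primrec.fst) (PrimrecPred.and ?_ ?_)
    · exact Primrec.eq.comp (primrec_int_sub_toNat.comp Primrec.snd
        (Primrec.snd.comp (Primrec.fst.comp Primrec.fst))) (Primrec.snd.comp Primrec.fst)
    · exact Primrec.eq.comp (primrec_int_sub_toNat.comp
        (Primrec.snd.comp (Primrec.fst.comp Primrec.fst)) Primrec.snd) (Primrec.const 0)
  refine h.of_eq fun x i => ⟨?_, fun hmem => ⟨_, hmem, by omega, by omega⟩⟩
  rintro ⟨c, hc, hi, h0⟩
  rwa [show x.2 + (i : ℤ) = c by omega]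

theorem computable_map_range {F : σ → ℕ → β} (hF : Computable₂ F) :
    Computable₂ fun s n => (List.range n).map (F s) := by
  have h : Computable₂ fun (q : σ × ℕ) (y : ℕ × List β) => y.2 ++ [F q.1 y.1] :=
    Computable.list_concat.comp (Computable.snd.comp Computable.snd)
      (hF.comp (Computable.fst.comp Computable.fst) (Computable.fst.comp Computable.snd))
  refine (Computable.nat_rec Computable.snd (Computable.const []) h).of_eq fun ⟨s, n⟩ => ?_
  induction n with
  | zero => rfl
  | succ n ih =>
    simp only at ih ⊢
    rw [ih, List.range_succ, List.map_append]
    rfl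

end Primrec

/-- The numbers of points of the list `s` in the windows of length at most `M` that start at a point
of `s` are bounded by `p`: the finite check that decides admissibility of the set of points of `s`
when all of them lie in a window of length `M`. -/
def WindowBounds (p : ℕ → ℕ) (M : ℕ) (s : List ℤ) : Prop :=
  ∀ a ∈ s, ∀ m ≤ M, Nat.count (fun i => a + (i : ℤ) ∈ s) m ≤ p m

instance (p : ℕ → ℕ) (M : ℕ) (s : List ℤ) : Decidable (WindowBounds p M s) :=
  inferInstanceAs (Decidable (∀ a ∈ s, ∀ m ≤ M, Nat.count (fun i => a + (i : ℤ) ∈ s) m ≤ p m))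

theorem windowBounds_congr {p p' : ℕ → ℕ} {M : ℕ} (h : ∀ m ≤ M, p m = p' m) (s : List ℤ) :
    WindowBounds p M s ↔ WindowBounds p' M s :=
  forall₂_congr fun a _ => forall₂_congr fun m hm => by rw [h m hm]

theorem admissible_iff_windowBounds {p : ℕ → ℕ} (hp : Monotone p) {M : ℕ} {s : List ℤ}
    (hM : ∀ a ∈ s, ∀ b ∈ s, b - a < M) : Admissible p {t | t ∈ s} ↔ WindowBounds p M s := by
  constructor
  · intro h a _ m _
    rw [Nat.count_eq_card_filter_range, ← Finset.card_image_of_injective (f := fun i : ℕ => a + i) _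
      (fun i j hij => by simpa using hij)]
    refine h _ m ?_ ?_
    · simp only [Set.subset_def, Finset.mem_coe, Finset.forall_mem_image, Finset.mem_filter]
      exact fun i hi => hi.2
    · simp only [Finset.forall_mem_image, Finset.mem_filter, Finset.mem_range]
      intro i hi j _
      omega
  · intro h F m hF hm
    rcases F.eq_empty_or_nonempty with rfl | hne
    · simp
    have hmin := F.min'_mem hne
    refine le_trans ?_ ((h _ (hF hmin) (min m M) (min_le_right _ _)).trans (hp (min_le_left _ _)))
    rw [Nat.count_eq_card_filter_range]
    refine Finset.card_le_card_of_injOn (fun t => (t - F.min' hne).toNat) (fun t ht => ?_) ?_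
    · have hle := F.min'_le t ht
      have hlt := hm t ht _ hmin
      have hltM := hM _ (hF hmin) t (hF ht)
      simp only [Finset.coe_filter, Finset.mem_range, Set.mem_ofPred_eq]
      exact ⟨by omega, by simpa [Int.toNat_of_nonneg (sub_nonneg.2 hle)] using hF ht⟩
    · intro t ht u hu htu
      have := F.min'_le t ht
      have := F.min'_le u hu
      simp only at htu
      omega

/-- The positions of the nonzero ones among the last `n` digits of `c` in base `K + 1`: the support
of the word of length `n` with number `c`. -/
def wordSupport (K n c : ℕ) : List ℤ :=
  ((List.range n).filter fun i => c / (K + 1) ^ i % (K + 1) ≠ 0).map (↑)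

theorem mem_wordSupport {K n : ℕ} (g : Fin n → Fin (K + 1)) (t : ℤ) :
    t ∈ wordSupport K n (finFunctionFinEquiv g) ↔ ∃ i : Fin n, (i : ℤ) = t ∧ g i ≠ 0 := by
  have digit (i : Fin n) : (finFunctionFinEquiv g : ℕ) / (K + 1) ^ (i : ℕ) % (K + 1) = g i := by
    conv_rhs => rw [← finFunctionFinEquiv.symm_apply_apply g]
    rfl
  simp only [wordSupport, List.mem_map, List.mem_filter, List.mem_range, decide_eq_true_eq]
  constructor
  · rintro ⟨i, ⟨hi, h⟩, rfl⟩
    refine ⟨⟨i, hi⟩, rfl, fun h0 => h ?_⟩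
    rw [digit ⟨i, hi⟩, h0, Fin.val_zero]
  · rintro ⟨i, rfl, h⟩
    exact ⟨i, ⟨i.2, by rw [digit]; exact Fin.val_ne_zero_iff.2 h⟩, rfl⟩

/-- The number of admissible words of length `n`, found by a search among all words. -/
def wordCount (K : ℕ) (p : ℕ → ℕ) (n : ℕ) : ℕ :=
  Nat.count (fun c => WindowBounds p n (wordSupport K n c)) ((K + 1) ^ n)

theorem wordCount_congr {K n : ℕ} {p p' : ℕ → ℕ} (h : ∀ m ≤ n, p m = p' m) :
    wordCount K p n = wordCount K p' n := by
  simp only [wordCount, windowBounds_congr h]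

theorem restrict_mem_iff_windowBounds {p : ℕ → ℕ} (hp : Monotone p) {K n : ℕ}
    {x : ℤ → Fin (K + 1)} (hx : ∀ t, x t ≠ 0 → 0 ≤ t ∧ t < n) :
    x ∈ blocks p K n ↔
      WindowBounds p n (wordSupport K n (finFunctionFinEquiv fun i : Fin n => x (i : ℕ))) := by
  rw [← admissible_iff_windowBounds hp]
  · simp only [mem_wordSupport, blocks, Set.mem_ofPred_eq, and_iff_left hx]
    refine iff_of_eq (congrArg _ (Set.ext fun t => ?_))
    constructor
    · intro h
      obtain ⟨h0, hn⟩ := hx t h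
      lift t to ℕ using h0
      exact ⟨⟨t, by omega⟩, rfl, h⟩
    · rintro ⟨i, rfl, h⟩
      exact h
  · simp only [mem_wordSupport]
    rintro _ ⟨i, rfl, -⟩ _ ⟨j, rfl, -⟩
    omega

theorem wordCount_eq_ncard_blocks {p : ℕ → ℕ} (hp : Monotone p) (K n : ℕ) :
    wordCount K p n = (blocks p K n).ncard := by
  rw [wordCount, Nat.count_eq_card_filter_range, ← Set.ncard_coe_finset]
  refine (Set.ncard_congr (fun x _ => (finFunctionFinEquiv fun i : Fin n => x (i : ℕ) : ℕ))
    (fun x hx => ?_) (fun x y hx hy h => ?_) fun c hc => ?_).symm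
  · simp only [Finset.coe_filter, Finset.mem_range, Set.mem_ofPred_eq]
    exact ⟨Fin.is_lt _, (restrict_mem_iff_windowBounds hp hx.2).1 hx⟩
  · exact blocks_injOn n hx hy (finFunctionFinEquiv.injective (Fin.val_injective h))
  · simp only [Finset.coe_filter, Finset.mem_range, Set.mem_ofPred_eq] at hc
    obtain ⟨g, hg⟩ := finFunctionFinEquiv.surjective (⟨c, hc.1⟩ : Fin ((K + 1) ^ n))
    have hgc : (finFunctionFinEquiv g : ℕ) = c := congrArg Fin.val hg
    let x : ℤ → Fin (K + 1) := Function.extend (fun i : Fin n => ((i : ℕ) : ℤ)) g fun _ => 0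
    have hxg (i : Fin n) : x (i : ℕ) = g i :=
      Function.Injective.extend_apply (fun i j h => Fin.ext (by simpa using h)) g _ i
    have hx (t : ℤ) (ht : x t ≠ 0) : 0 ≤ t ∧ t < n := by
      by_cases h : ∃ i : Fin n, ((i : ℕ) : ℤ) = t
      · obtain ⟨i, rfl⟩ := h
        omega
      · exact absurd (Function.extend_apply' g _ t h) ht
    refine ⟨x, (restrict_mem_iff_windowBounds hp hx).2 ?_, ?_⟩
    · simpa only [hxg, hgc] using hc.2
    · simpa only [hxg] using hgc

/-! ### The computable profile -/

/-- The density has to grow after `n`, because two blocks that are glued to one of length at most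
`n + 1` would be too dense otherwise. -/
def NeedsIncrement (p G : ℕ → ℕ) (n : ℕ) : Prop :=
  ∃ a ≤ n, ∃ b ≤ a, a + b + G a ≤ n + 1 ∧ p n < p a + p b

/-- The gap has to grow after `n`: the bound `c` leaves room, and the entropy of the blocks of
length `n`, counted per symbol as if they had length `n + G n + 1`, exceeds one of the fractions
(numerator, denominator) in the list `Q`. -/
def NeedsGap (c : ℕ) (Q : List (ℕ × ℕ)) (K : ℕ) (p G : ℕ → ℕ) (n : ℕ) : Prop :=
  G n + 1 ≤ c ∧ ∃ x ∈ Q, 2 ^ (x.1 * (n + G n + 1)) < wordCount K p n ^ x.2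

instance (p G : ℕ → ℕ) (n : ℕ) : Decidable (NeedsIncrement p G n) :=
  inferInstanceAs (Decidable (∃ a ≤ n, ∃ b ≤ a, a + b + G a ≤ n + 1 ∧ p n < p a + p b))

instance (c : ℕ) (Q : List (ℕ × ℕ)) (K : ℕ) (p G : ℕ → ℕ) (n : ℕ) :
    Decidable (NeedsGap c Q K p G n) :=
  inferInstanceAs (Decidable (G n + 1 ≤ c ∧
    ∃ x ∈ Q, 2 ^ (x.1 * (n + G n + 1)) < wordCount K p n ^ x.2))

/-- Density and gap at `n + 1`, as functions of those up to `n`. -/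
def step (c : ℕ) (Q : List (ℕ × ℕ)) (K : ℕ) (p G : ℕ → ℕ) (n : ℕ) : ℕ × ℕ :=
  (if NeedsIncrement p G n then p n + 1 else p n, if NeedsGap c Q K p G n then G n + 1 else G n)

theorem step_congr {c K n : ℕ} {Q : List (ℕ × ℕ)} {p p' G G' : ℕ → ℕ} (hp : ∀ m ≤ n, p m = p' m)
    (hG : ∀ m ≤ n, G m = G' m) : step c Q K p G n = step c Q K p' G' n := by
  have hI : NeedsIncrement p G n ↔ NeedsIncrement p' G' n := exists_congr fun a =>
    and_congr_right fun ha => exists_congr fun b => and_congr_right fun hb => by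
      rw [hp a ha, hp b (hb.trans ha), hp n le_rfl, hG a ha]
  have hN : NeedsGap c Q K p G n ↔ NeedsGap c Q K p' G' n := by
    rw [NeedsGap, NeedsGap, hG n le_rfl, wordCount_congr hp]
  simp only [step, hI, hN, hp n le_rfl, hG n le_rfl]

/-- Increments by one suffice: shortening the second block by one lowers its density by at most
one. -/
theorem isProfile_of_increments {p G : ℕ → ℕ} (zero : p 0 = 0) (one : p 1 = 1)
    (succ : ∀ n, 1 ≤ n → p (n + 1) = if NeedsIncrement p G n then p n + 1 else p n)
    (gap_one : G 1 = 0) (gap_succ : ∀ n, G (n + 1) = G n ∨ G (n + 1) = G n + 1) :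
    IsProfile p G := by
  have step_le (n : ℕ) : p n ≤ p (n + 1) ∧ p (n + 1) ≤ p n + 1 := by
    rcases n.eq_zero_or_pos with rfl | hn
    · rw [zero, zero_add, one]
      exact ⟨zero_le_one, le_rfl⟩
    · rw [succ n hn]
      split_ifs <;> omega
  have mono : Monotone p := monotone_nat_of_le_succ fun n => (step_le n).1
  refine ⟨zero, one, mono, fun a b hb => ?_, fun n hn => ?_, gap_one, gap_succ⟩
  · induction b with
    | zero =>
      rw [zero]
      exact mono (by omega)
    | succ b ih =>
      have hm := ih (by omega)
      have hb1 := (step_le b).2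
      rw [show a + (b + 1) + G a = a + b + G a + 1 by ring, succ (a + b + G a) (by omega)]
      split_ifs with h
      · omega
      · by_contra! hlt
        exact h ⟨a, by omega, b + 1, hb, by omega, hlt⟩
  · rw [succ n hn]
    split_ifs with h
    · obtain ⟨a, ha, b, hb, hab, hlt⟩ := h
      exact Or.inr ⟨a, b, hb, ha, hab, hlt⟩
    · exact Or.inl le_rfl

/-- The density at `m` in the table `l` of densities and gaps. -/
def densityAt (l : List (ℕ × ℕ)) (m : ℕ) : ℕ := (l.getD m (0, 0)).1

/-- The gap at `m` in the table `l` of densities and gaps. -/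
def gapAt (l : List (ℕ × ℕ)) (m : ℕ) : ℕ := (l.getD m (0, 0)).2

/-- The entry that continues the table `l`. -/
def nextEntry (c : ℕ) (Q : List (ℕ × ℕ)) (K : ℕ) (l : List (ℕ × ℕ)) : ℕ × ℕ :=
  if l.length ≤ 1 then (l.length, 0) else step c Q K (densityAt l) (gapAt l) (l.length - 1)

/-- The table of the densities and gaps at the lengths below `n`, for the bound `f` on the gaps, the
approximations `q` of the entropy (numerators and denominators) and the alphabet `{0, …, K}`. -/
def table (f : ℕ → ℕ) (q : ℕ → ℕ × ℕ) (K : ℕ) : ℕ → List (ℕ × ℕ)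
  | 0 => []
  | n + 1 => table f q K n ++ [nextEntry (f (n - 1)) ((List.range n).map q) K (table f q K n)]

theorem two_pow_lt_pow_iff {a b m N : ℕ} (hb : b ≠ 0) (hN : N ≠ 0) :
    2 ^ (a * m) < N ^ b ↔ (a : ℝ) / b * m < Real.logb 2 N := by
  have hb' : (0 : ℝ) < b := by exact_mod_cast Nat.pos_of_ne_zero hb
  have : (0 : ℝ) < N := by exact_mod_cast Nat.pos_of_ne_zero hN
  calc 2 ^ (a * m) < N ^ b ↔ (2 : ℝ) ^ (a * m) < (N : ℝ) ^ b := by exact_mod_cast Iff.rfl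
    _ ↔ (a * m : ℝ) < b * Real.logb 2 N := by
      rw [← Real.logb_lt_logb_iff one_lt_two (by positivity) (by positivity), Real.logb_pow,
        Real.logb_pow, Real.logb_self_eq_one one_lt_two, mul_one, Nat.cast_mul]
    _ ↔ (a : ℝ) / b * m < Real.logb 2 N := by
      rw [div_mul_eq_mul_div, div_lt_iff₀ hb', mul_comm (b : ℝ)]

section table

variable (f : ℕ → ℕ) (q : ℕ → ℕ × ℕ) (K : ℕ)

/-- The entry of `table` at `n`. -/
def entry (n : ℕ) : ℕ × ℕ :=
  nextEntry (f (n - 1)) ((List.range n).map q) K (table f q K n)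

/-- The density profile listed in `table`. -/
def profile (n : ℕ) : ℕ := (entry f q K n).1

/-- The gap function listed in `table`. -/
def gap (n : ℕ) : ℕ := (entry f q K n).2

theorem table_eq (n : ℕ) : table f q K n = (List.range n).map (entry f q K) := by
  induction n with
  | zero => rfl
  | succ n ih =>
    rw [List.range_succ, List.map_append, ← ih]
    rfl

theorem length_table (n : ℕ) : (table f q K n).length = n := by
  rw [table_eq, List.length_map, List.length_range]

theorem getD_table {m n : ℕ} (h : m < n) : (table f q K n).getD m (0, 0) = entry f q K m := by
  rw [table_eq, List.getD_eq_getElem _ _ (by simpa using h), List.getElem_map, List.getElem_range]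

theorem densityAt_table {m n : ℕ} (h : m < n) : densityAt (table f q K n) m = profile f q K m :=
  congrArg Prod.fst (getD_table f q K h)

theorem gapAt_table {m n : ℕ} (h : m < n) : gapAt (table f q K n) m = gap f q K m :=
  congrArg Prod.snd (getD_table f q K h)

theorem entry_succ {n : ℕ} (hn : 1 ≤ n) : entry f q K (n + 1) =
    step (f n) ((List.range (n + 1)).map q) K (profile f q K) (gap f q K) n := by
  rw [entry, nextEntry, length_table, if_neg (by omega)]
  exact step_congr (fun m hm => densityAt_table f q K (Nat.lt_succ_of_le hm))
    fun m hm => gapAt_table f q K (Nat.lt_succ_of_le hm)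

theorem isProfile_profile : IsProfile (profile f q K) (gap f q K) := by
  refine isProfile_of_increments rfl rfl (fun n hn => ?_) rfl fun n => ?_
  · rw [profile, entry_succ f q K hn, step]
  · rcases n.eq_zero_or_pos with rfl | hn
    · exact Or.inl rfl
    · rw [gap, entry_succ f q K hn]
      simp only [step]
      split_ifs
      exacts [Or.inr rfl, Or.inl rfl]

theorem followsRule_profile (hq : ∀ i, (q i).2 ≠ 0) :
    FollowsRule f (fun i => ((q i).1 : ℝ) / (q i).2) K (profile f q K) (gap f q K) := by
  intro n hn
  have hgap : gap f q K (n + 1) = gap f q K n + 1 ↔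
      NeedsGap (f n) ((List.range (n + 1)).map q) K (profile f q K) (gap f q K) n := by
    rw [gap, entry_succ f q K hn, step]
    simp
  rw [hgap, NeedsGap, wordCount_eq_ncard_blocks (isProfile_profile f q K).mono]
  refine and_congr_right' ?_
  simp only [List.mem_map, List.mem_range, exists_exists_and_eq_and, Nat.lt_succ_iff]
  refine exists_congr fun i => and_congr_right' ?_
  rw [two_pow_lt_pow_iff (hq i) (ncard_blocks_pos n).ne', logBlocks]
  push_cast
  rfl

end table

section Primrec

variable {α : Type*} [Primcodable α] {L : α → List (ℕ × ℕ)}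

theorem primrec_densityAt {m : α → ℕ} (hL : Primrec L) (hm : Primrec m) :
    Primrec fun x => densityAt (L x) (m x) :=
  Primrec.fst.comp ((Primrec.list_getD (0, 0)).comp hL hm)

theorem primrec_gapAt {m : α → ℕ} (hL : Primrec L) (hm : Primrec m) :
    Primrec fun x => gapAt (L x) (m x) :=
  Primrec.snd.comp ((Primrec.list_getD (0, 0)).comp hL hm)

theorem primrecPred_windowBounds {M : α → ℕ} {s : α → List ℤ} (hL : Primrec L) (hM : Primrec M)
    (hs : Primrec s) : PrimrecPred fun x => WindowBounds (densityAt (L x)) (M x) (s x) := by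
  refine primrecPred_forall_mem hs (primrecPred_forall_le (hM.comp Primrec.fst) ?_)
  refine Primrec.nat_le.comp (primrec_count Primrec.snd ?_)
    (primrec_densityAt (hL.comp (Primrec.fst.comp Primrec.fst)) Primrec.snd)
  exact primrecRel_int_add_mem.comp (Primrec.pair
    (hs.comp (Primrec.fst.comp (Primrec.fst.comp Primrec.fst)))
    (Primrec.snd.comp (Primrec.fst.comp Primrec.fst))) Primrec.snd

theorem primrec_wordSupport (K : ℕ) : Primrec₂ (wordSupport K) := by
  refine Primrec.list_map (primrec_filter (Primrec.list_range.comp Primrec.fst) ?_)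
    (primrec_int_natCast.comp Primrec.snd)
  exact (Primrec.eq.comp (Primrec.nat_mod.comp (Primrec.nat_div.comp
    (Primrec.snd.comp Primrec.fst) (primrec_nat_pow.comp (Primrec.const (K + 1)) Primrec.snd))
    (Primrec.const (K + 1))) (Primrec.const 0)).not

theorem primrec_wordCount (K : ℕ) {n : α → ℕ} (hL : Primrec L) (hn : Primrec n) :
    Primrec fun x => wordCount K (densityAt (L x)) (n x) :=
  primrec_count (primrec_nat_pow.comp (Primrec.const (K + 1)) hn)
    (primrecPred_windowBounds (hL.comp Primrec.fst) (hn.comp Primrec.fst)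
      ((primrec_wordSupport K).comp (hn.comp Primrec.fst) Primrec.snd))

theorem primrecPred_needsIncrement {n : α → ℕ} (hL : Primrec L) (hn : Primrec n) :
    PrimrecPred fun x => NeedsIncrement (densityAt (L x)) (gapAt (L x)) (n x) := by
  refine primrecPred_exists_le hn (primrecPred_exists_le Primrec.snd (PrimrecPred.and ?_ ?_))
  · exact Primrec.nat_le.comp (Primrec.nat_add.comp (Primrec.nat_add.comp
      (Primrec.snd.comp Primrec.fst) Primrec.snd)
      (primrec_gapAt (hL.comp (Primrec.fst.comp Primrec.fst)) (Primrec.snd.comp Primrec.fst)))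
      (Primrec.succ.comp (hn.comp (Primrec.fst.comp Primrec.fst)))
  · have hL' := hL.comp (Primrec.fst.comp (Primrec.fst (α := α × ℕ) (β := ℕ)))
    exact Primrec.nat_lt.comp (primrec_densityAt hL' (hn.comp (Primrec.fst.comp Primrec.fst)))
      (Primrec.nat_add.comp (primrec_densityAt hL' (Primrec.snd.comp Primrec.fst))
        (primrec_densityAt hL' Primrec.snd))

theorem primrecPred_needsGap (K : ℕ) {n c : α → ℕ} {Q : α → List (ℕ × ℕ)} (hc : Primrec c)
    (hQ : Primrec Q) (hL : Primrec L) (hn : Primrec n) :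
    PrimrecPred fun x => NeedsGap (c x) (Q x) K (densityAt (L x)) (gapAt (L x)) (n x) := by
  have hG := primrec_gapAt hL hn
  refine PrimrecPred.and (Primrec.nat_le.comp (Primrec.succ.comp hG) hc)
    (primrecPred_exists_mem hQ (Primrec.nat_lt.comp ?_ ?_))
  · exact primrec_nat_pow.comp (Primrec.const 2) (Primrec.nat_mul.comp
      (Primrec.fst.comp Primrec.snd)
      (Primrec.succ.comp (Primrec.nat_add.comp (hn.comp Primrec.fst) (hG.comp Primrec.fst))))
  · exact primrec_nat_pow.comp ((primrec_wordCount K hL hn).comp Primrec.fst)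
      (Primrec.snd.comp Primrec.snd)

theorem primrec_nextEntry (K : ℕ) {c : α → ℕ} {Q : α → List (ℕ × ℕ)} (hc : Primrec c)
    (hQ : Primrec Q) (hL : Primrec L) : Primrec fun x => nextEntry (c x) (Q x) K (L x) := by
  have hlen := Primrec.list_length.comp hL
  have hn := Primrec.pred.comp hlen
  have hp := primrec_densityAt hL hn
  have hG := primrec_gapAt hL hn
  refine Primrec.ite (Primrec.nat_le.comp hlen (Primrec.const 1))
    (Primrec.pair hlen (Primrec.const 0)) (Primrec.pair ?_ ?_)
  · exact Primrec.ite (primrecPred_needsIncrement hL hn) (Primrec.succ.comp hp) hp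
  · exact Primrec.ite (primrecPred_needsGap K hc hQ hL hn) (Primrec.succ.comp hG) hG

theorem computable_table {f : ℕ → ℕ} {q : α → ℕ → ℕ × ℕ} (hf : Computable f) (hq : Computable₂ q)
    (K : ℕ) : Computable₂ fun x n => table f (q x) K n := by
  have h : Computable fun x : (ℕ × List (ℕ × ℕ)) × List (ℕ × ℕ) => nextEntry x.1.1 x.1.2 K x.2 :=
    (primrec_nextEntry K (Primrec.fst.comp Primrec.fst) (Primrec.snd.comp Primrec.fst)
      Primrec.snd).to_comp
  have hlen : Computable fun x : α × List (ℕ × ℕ) => x.2.length :=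
    Computable.list_length.comp Computable.snd
  have hargs : Computable fun x : α × List (ℕ × ℕ) =>
      ((f (x.2.length - 1), (List.range x.2.length).map (q x.1)), x.2) :=
    Computable.pair (Computable.pair (hf.comp (Primrec.pred.to_comp.comp hlen))
      ((computable_map_range hq).comp Computable.fst hlen)) Computable.snd
  have hnext : Computable₂ fun (x : α) (l : List (ℕ × ℕ)) =>
      nextEntry (f (l.length - 1)) ((List.range l.length).map (q x)) K l :=
    (h.comp hargs).of_eq fun _ => rfl
  have hentry : Computable₂ fun x n => entry f (q x) K n :=
    Computable.nat_strong_rec _ (Computable.option_some.comp₂ hnext) fun x n => by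
      rw [← table_eq, length_table, entry]
  exact (computable_map_range hentry).of_eq fun ⟨x, n⟩ => (table_eq f (q x) K n).symm

end Primrec

/-! ### Decidability of the density shift -/

section decision

variable {d K : ℕ}

/-- The first coordinates of the nonzero symbols of the pattern `w` whose further coordinates are
`r`. -/
def rowSupport (w : List ((Fin (d + 1) → ℤ) × Fin (K + 1))) (r : Fin d → ℤ) : List ℤ :=
  (w.filter fun c => c.2 ≠ 0 ∧ Fin.tail c.1 = r).map fun c => c.1 0

/-- A bound that exceeds all differences of the first coordinates of entries of `w`. -/
def spanBound (w : List ((Fin (d + 1) → ℤ) × Fin (K + 1))) : ℕ :=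
  (w.map fun c => 2 * (c.1 0).natAbs + 1).sum

/-- The finite check that decides whether `w` is in the language of the density shift of `p`. -/
def Accepts (p : ℕ → ℕ) (w : List ((Fin (d + 1) → ℤ) × Fin (K + 1))) : Prop :=
  (∀ a ∈ w, ∀ b ∈ w, a.1 = b.1 → a.2 = b.2) ∧
    ∀ a ∈ w, WindowBounds p (spanBound w) (rowSupport w (Fin.tail a.1))

theorem mem_rowSupport {w : List ((Fin (d + 1) → ℤ) × Fin (K + 1))} {r : Fin d → ℤ} {t : ℤ} :
    t ∈ rowSupport w r ↔ ∃ a, a ≠ 0 ∧ (Fin.cons t r, a) ∈ w := by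
  simp only [rowSupport, List.mem_map, List.mem_filter, decide_eq_true_eq]
  constructor
  · rintro ⟨c, ⟨hc, h0, rfl⟩, rfl⟩
    exact ⟨c.2, h0, by rwa [Fin.cons_self_tail]⟩
  · rintro ⟨a, h0, ha⟩
    exact ⟨_, ⟨ha, h0, Fin.tail_cons _ _⟩, rfl⟩

theorem sub_lt_spanBound {w : List ((Fin (d + 1) → ℤ) × Fin (K + 1))} {r : Fin d → ℤ} :
    ∀ s ∈ rowSupport w r, ∀ t ∈ rowSupport w r, t - s < spanBound w := by
  have bound : ∀ t ∈ rowSupport w r, 2 * t.natAbs + 1 ≤ spanBound w := by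
    intro t ht
    obtain ⟨c, hc, rfl⟩ := List.mem_map.1 ht
    exact List.le_sum_of_mem (List.mem_map.2 ⟨c, (List.mem_filter.1 hc).1, rfl⟩)
  intro s hs t ht
  have := bound s hs
  have := bound t ht
  omega

theorem accepts_iff_mem_language {p : ℕ → ℕ} (hp : Monotone p)
    {w : List ((Fin (d + 1) → ℤ) × Fin (K + 1))} :
    Accepts p w ↔ w ∈ language (densityShift d K p) := by
  rw [mem_language_densityShift]
  refine and_congr_right' ?_
  simp only [← mem_rowSupport]
  constructor
  · intro h r F m hF
    rcases F.eq_empty_or_nonempty with rfl | ⟨t, ht⟩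
    · simp
    obtain ⟨a, -, ha⟩ := mem_rowSupport.1 (hF ht)
    have hr := h _ ha
    rw [Fin.tail_cons] at hr
    exact (admissible_iff_windowBounds hp sub_lt_spanBound).2 hr F m hF
  · exact fun h a _ => (admissible_iff_windowBounds hp sub_lt_spanBound).1 (h _)

theorem accepts_congr {p p' : ℕ → ℕ} {w : List ((Fin (d + 1) → ℤ) × Fin (K + 1))}
    (h : ∀ m ≤ spanBound w, p m = p' m) : Accepts p w ↔ Accepts p' w := by
  simp only [Accepts, windowBounds_congr h]

theorem primrec_first : Primrec fun a : (Fin (d + 1) → ℤ) × Fin (K + 1) => a.1 0 :=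
  Primrec.fin_app.comp Primrec.fst (Primrec.const 0)

theorem primrec_tail : Primrec fun a : (Fin (d + 1) → ℤ) × Fin (K + 1) => Fin.tail a.1 :=
  Primrec.fin_curry.2 (Primrec.fin_app.comp (Primrec.fst.comp Primrec.fst)
    (Primrec.fin_succ.comp Primrec.snd))

theorem primrec_spanBound :
    Primrec (spanBound : List ((Fin (d + 1) → ℤ) × Fin (K + 1)) → ℕ) := by
  have natAbs : Primrec Int.natAbs :=
    (Primrec.nat_add.comp primrec_int_toNat primrec_int_neg_toNat).of_eq fun z => by omega
  refine Primrec.list_foldr (h := fun _ x => x.1 + x.2) (Primrec.list_map Primrec.id ?_)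
    (Primrec.const 0) (Primrec.nat_add.comp (Primrec.fst.comp Primrec.snd)
      (Primrec.snd.comp Primrec.snd))
  exact Primrec.succ.comp (Primrec.nat_mul.comp (Primrec.const 2)
    (natAbs.comp (primrec_first.comp Primrec.snd)))

theorem primrec_rowSupport : Primrec₂ fun (w : List ((Fin (d + 1) → ℤ) × Fin (K + 1)))
    (r : Fin d → ℤ) => rowSupport w r := by
  refine Primrec.list_map (primrec_filter Primrec.fst (PrimrecPred.and ?_ ?_))
    (primrec_first.comp Primrec.snd)
  · exact (Primrec.eq.comp (Primrec.snd.comp Primrec.snd) (Primrec.const 0)).not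
  · exact Primrec.eq.comp (primrec_tail.comp Primrec.snd) (Primrec.snd.comp Primrec.fst)

theorem primrecRel_accepts : PrimrecRel fun (l : List (ℕ × ℕ))
    (w : List ((Fin (d + 1) → ℤ) × Fin (K + 1))) => Accepts (densityAt l) w := by
  refine PrimrecPred.and ?_ (primrecPred_forall_mem Primrec.snd ?_)
  · have hconsistent : PrimrecRel fun a b : (Fin (d + 1) → ℤ) × Fin (K + 1) =>
        a.1 = b.1 → a.2 = b.2 :=
      ((Primrec.eq.comp (Primrec.fst.comp Primrec.fst) (Primrec.fst.comp Primrec.snd)).not.or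
        (Primrec.eq.comp (Primrec.snd.comp Primrec.fst) (Primrec.snd.comp Primrec.snd))).of_eq
        fun _ => imp_iff_not_or.symm
    exact primrecPred_forall_mem Primrec.snd (primrecPred_forall_mem
      (Primrec.snd.comp Primrec.fst) (hconsistent.comp (Primrec.snd.comp Primrec.fst) Primrec.snd))
  · exact primrecPred_windowBounds (Primrec.fst.comp Primrec.fst)
      (primrec_spanBound.comp (Primrec.snd.comp Primrec.fst))
      (primrec_rowSupport.comp (Primrec.snd.comp Primrec.fst) (primrec_tail.comp Primrec.snd))

theorem computablePred_language {σ : Type*} [Primcodable σ] {f : ℕ → ℕ} (hf : Computable f)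
    {q : σ → ℕ → ℕ × ℕ} (hq : Computable₂ q) :
    ComputablePred fun x : σ × List ((Fin (d + 1) → ℤ) × Fin (K + 1)) =>
      x.2 ∈ language (densityShift d K (profile f (q x.1) K)) := by
  classical
  have htable : Computable fun x : σ × List ((Fin (d + 1) → ℤ) × Fin (K + 1)) =>
      table f (q x.1) K (spanBound x.2 + 1) :=
    (computable_table hf hq K).comp Computable.fst
      (Computable.succ.comp (primrec_spanBound.to_comp.comp Computable.snd))
  have haccepts : ComputablePred fun x : σ × List ((Fin (d + 1) → ℤ) × Fin (K + 1)) =>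
      Accepts (densityAt (table f (q x.1) K (spanBound x.2 + 1))) x.2 :=
    ⟨inferInstance, primrecRel_accepts.decide.to_comp.comp htable Computable.snd⟩
  refine haccepts.of_eq fun x => (accepts_congr fun m hm => ?_).trans
    (accepts_iff_mem_language (isProfile_profile f (q x.1) K).mono)
  exact densityAt_table f (q x.1) K (Nat.lt_succ_of_le hm)

end decision

/-! ### The realization of entropies and the reduction from the halting problem -/

theorem densityShift_profile_spec {f : ℕ → ℕ} (hmono : Monotone f)
    (hsum : ¬ Summable fun n : ℕ => (f n : ℝ) / (n : ℝ) ^ 2) {q : ℕ → ℕ × ℕ}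
    (hq : ∀ i, (q i).2 ≠ 0) {α : ℝ} (hα : 0 ≤ α)
    (ha : IsGLB (Set.range fun i => ((q i).1 : ℝ) / (q i).2) α) {K : ℕ}
    (hK : (2 : ℝ) ^ α ≤ K + 1) (d : ℕ) :
    IsIrreducible f (densityShift d K (profile f q K)) ∧
      HasEntropy (densityShift d K (profile f q K)) α := by
  have h := isProfile_profile f q K
  have hrule := followsRule_profile f q K hq
  refine ⟨isIrreducible_densityShift h.mono fun n a b hn hb =>
    h.glue_of_le (h.gap_succ_le hrule hmono n) hn hb, ?_⟩
  rw [← h.blockEntropy_eq hrule hα ((Real.le_logb_iff_rpow_le one_lt_two (by positivity)).2 hK) ha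
    hmono hsum]
  exact hasEntropy_densityShift

theorem IsPi1Computable.exists_fractions {α : ℝ} (hα : 0 ≤ α) (h : IsPi1Computable α) :
    ∃ q : ℕ → ℕ × ℕ, Computable q ∧ (∀ i, (q i).2 ≠ 0) ∧
      IsGLB (Set.range fun i => ((q i).1 : ℝ) / (q i).2) α := by
  obtain ⟨φ, ⟨a, b, ha, hb, hφ⟩, hglb⟩ := h
  refine ⟨fun i => ((a i).toNat, b i), Computable.pair (primrec_int_toNat.to_comp.comp ha) hb,
    fun i => (hφ i).1, ?_⟩
  convert hglb using 3 with i
  have hφi : 0 ≤ φ i := Rat.cast_nonneg.1 (hα.trans (hglb.1 ⟨i, rfl⟩))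
  have hb0 : (0 : ℚ) < b i := by exact_mod_cast Nat.pos_of_ne_zero (hφ i).1
  have ha0 : 0 ≤ a i := by
    rw [(hφ i).2, le_div_iff₀ hb0, zero_mul] at hφi
    exact_mod_cast hφi
  have htoNat : (((a i).toNat : ℕ) : ℝ) = a i := by exact_mod_cast Int.toNat_of_nonneg ha0
  rw [htoNat, (hφ i).2]
  push_cast
  rfl

theorem exists_decidable_irreducible {f : ℕ → ℕ} (hf : Computable f) (hmono : Monotone f)
    (hsum : ¬ Summable fun n : ℕ => (f n : ℝ) / (n : ℝ) ^ 2) (d : ℕ) {α : ℝ} (hα : 0 ≤ α)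
    (hpi : IsPi1Computable α) {K : ℕ} (hK : (2 : ℝ) ^ α ≤ K + 1) :
    ∃ X : ZSubshift (d + 1) (K + 1), IsDecidable X ∧ IsIrreducible f X ∧ HasEntropy X α := by
  obtain ⟨q, hqc, hq0, hglb⟩ := hpi.exists_fractions hα
  refine ⟨densityShift d K (profile f q K), ?_,
    densityShift_profile_spec hmono hsum hq0 hα hglb hK d⟩
  obtain ⟨_, hlang⟩ := computablePred_language (d := d) (K := K) (σ := Unit) hf
    (hqc.comp Computable.snd).to₂
  exact ⟨fun w => inferInstanceAs (Decidable (((), w).2 ∈ language _)),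
    hlang.comp (Computable.pair (Computable.const ()) Computable.id)⟩

theorem exists_code_of_computablePred {β : Type*} [Primcodable β] {P : β → Prop} [DecidablePred P]
    (h : ComputablePred P) : ∃ c : Nat.Partrec.Code, ∀ b,
      c.eval (Encodable.encode b) = Part.some (if P b then 1 else 0) := by
  have hchar : Computable fun b => cond (decide (P b)) 1 0 :=
    Computable.cond h.decide (Computable.const 1) (Computable.const 0)
  have hcode : Computable fun n : ℕ => ((Encodable.decode (α := β) n).map
      fun b => cond (decide (P b)) 1 0).getD 0 :=
    Computable.option_getD (Computable.option_map Computable.decode (hchar.comp Computable.snd).to₂)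
      (Computable.const 0)
  obtain ⟨c, hc⟩ := Nat.Partrec.Code.exists_code.1 (Partrec.nat_iff.1 hcode.partrec)
  refine ⟨c, fun b => ?_⟩
  rw [hc]
  simp [Bool.cond_decide]

theorem exists_computable_decides {σ : Type*} [Primcodable σ] {d k : ℕ} (X : σ → ZSubshift d k)
    (h : ComputablePred fun x : σ × List ((Fin d → ℤ) × Fin k) => x.2 ∈ language (X x.1)) :
    ∃ c : σ → Nat.Partrec.Code, Computable c ∧ ∀ s, Decides (c s) (X s) := by
  classical
  obtain ⟨c, hc⟩ := exists_code_of_computablePred h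
  refine ⟨fun s => c.curry (Encodable.encode s),
    Nat.Partrec.Code.primrec₂_curry.to_comp.comp (Computable.const c) Computable.encode,
    fun s w => ?_⟩
  have heval : (c.curry (Encodable.encode s)).eval (patternCode w) =
      Part.some (if w ∈ language (X s) then 1 else 0) := by
    rw [Nat.Partrec.Code.eval_curry]
    exact hc (s, w)
  rw [heval]
  constructor <;> intro hw <;> simp [hw]

/-- The fractions (numerator, denominator) equal to `1` or, from the time on when the program `c` is
seen to halt on input `0`, to `1 / 2`. Their infimum tells whether `c` halts. -/
def haltingFractions (c : Nat.Partrec.Code) (n : ℕ) : ℕ × ℕ :=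
  (1, cond (c.evaln n 0).isSome 2 1)

theorem haltingFractions_snd_ne_zero (c : Nat.Partrec.Code) (n : ℕ) :
    (haltingFractions c n).2 ≠ 0 := by
  cases h : (c.evaln n 0).isSome <;> simp [haltingFractions, h]

theorem computable_haltingFractions : Computable₂ haltingFractions := by
  refine Computable.pair (Computable.const 1) (Computable.cond ?_ (Computable.const 2)
    (Computable.const 1))
  exact (Primrec.option_isSome.comp (Nat.Partrec.Code.primrec_evaln.comp (Primrec.pair
    (Primrec.pair Primrec.snd Primrec.fst) (Primrec.const 0)))).to_comp

theorem exists_evaln_isSome_iff_dom {c : Nat.Partrec.Code} {x : ℕ} :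
    (∃ n, (c.evaln n x).isSome) ↔ (c.eval x).Dom := by
  simp only [Option.isSome_iff_exists, Part.dom_iff_mem, Nat.Partrec.Code.evaln_complete,
    Option.mem_def]
  exact exists_comm

open Classical in
theorem isGLB_haltingFractions (c : Nat.Partrec.Code) :
    IsGLB (Set.range fun i => ((haltingFractions c i).1 : ℝ) / (haltingFractions c i).2)
      (if (c.eval 0).Dom then 1 / 2 else 1) := by
  have hval (i : ℕ) : ((haltingFractions c i).1 : ℝ) / (haltingFractions c i).2 =
      if (c.evaln i 0).isSome then 1 / 2 else 1 := by
    cases h : (c.evaln i 0).isSome <;> simp [haltingFractions, h]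
  simp only [hval, ← exists_evaln_isSome_iff_dom]
  split_ifs with hdom
  · obtain ⟨i, hi⟩ := hdom
    refine IsLeast.isGLB ⟨⟨i, if_pos hi⟩, Set.forall_mem_range.2 fun j => ?_⟩
    split_ifs <;> norm_num
  · rw [funext fun i => if_neg (not_exists.1 hdom i), Set.range_const]
    exact isGLB_singleton

open Classical in
theorem four_mul_toNat_lt_iff {P : Prop} {z : ℤ} {b : ℕ} (hb : b ≠ 0)
    (h : |(if P then 1 / 2 else 1) - (z : ℝ) / b| ≤ (2 : ℝ)⁻¹ ^ 3) : 4 * z.toNat < 3 * b ↔ P := by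
  have hb0 : (0 : ℝ) < b := by exact_mod_cast Nat.pos_of_ne_zero hb
  have hiff : (z : ℝ) / b < 3 / 4 ↔ 4 * z.toNat < 3 * b := by
    rw [div_lt_div_iff₀ hb0 four_pos, ← Int.cast_natCast b]
    norm_cast
    omega
  rw [← hiff]
  split_ifs at h with hP <;> norm_num [abs_le] at h <;> simp only [hP, iff_true, iff_false] <;>
    linarith

theorem not_exists_computesEntropy {f : ℕ → ℕ} (hf : Computable f) (hmono : Monotone f)
    (hsum : ¬ Summable fun n : ℕ => (f n : ℝ) / (n : ℝ) ^ 2) (d : ℕ) {K : ℕ} (hK : 1 ≤ K) :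
    ¬ ∃ alg : Nat.Partrec.Code × ℕ →. ℤ × ℕ,
      Partrec alg ∧ ComputesEntropy f (d + 1) (K + 1) alg := by
  classical
  rintro ⟨alg, halg, hcomp⟩
  obtain ⟨c, hc, hdec⟩ := exists_computable_decides
    (fun e => densityShift d K (profile f (haltingFractions e) K))
    (computablePred_language hf computable_haltingFractions)
  have happrox (e : Nat.Partrec.Code) : ∃ r ∈ alg (c e, 3), r.2 ≠ 0 ∧
      |(if (e.eval 0).Dom then 1 / 2 else 1) - (r.1 : ℝ) / (r.2 : ℝ)| ≤ (2 : ℝ)⁻¹ ^ 3 := by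
    set α : ℝ := if (e.eval 0).Dom then 1 / 2 else 1 with hα
    have hα0 : 0 ≤ α := by rw [hα]; split_ifs <;> norm_num
    have hα1 : α ≤ 1 := by rw [hα]; split_ifs <;> norm_num
    have hsize : (2 : ℝ) ^ α ≤ K + 1 := calc
      (2 : ℝ) ^ α ≤ 2 ^ (1 : ℝ) := Real.rpow_le_rpow_of_exponent_le one_le_two hα1
      _ = 1 + 1 := by norm_num
      _ ≤ K + 1 := by gcongr; exact_mod_cast hK
    obtain ⟨hirr, hent⟩ := densityShift_profile_spec hmono hsum (haltingFractions_snd_ne_zero e)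
      hα0 (isGLB_haltingFractions e) hsize d
    exact hcomp _ densityShift_nonempty hirr (c e) (hdec e) _ hent 3
  choose r hr hr0 hrle using happrox
  have hrc : Computable r :=
    Partrec.of_eq_tot (halg.comp (Computable.pair hc (Computable.const 3))) hr
  have hlt : PrimrecPred fun x : ℤ × ℕ => 4 * x.1.toNat < 3 * x.2 :=
    Primrec.nat_lt.comp (Primrec.nat_mul.comp (Primrec.const 4)
      (primrec_int_toNat.comp Primrec.fst)) (Primrec.nat_mul.comp (Primrec.const 3) Primrec.snd)
  have hhalt : ComputablePred fun e => 4 * (r e).1.toNat < 3 * (r e).2 :=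
    ⟨inferInstance, hlt.decide.to_comp.comp hrc⟩
  exact ComputablePred.halting_problem 0
    (hhalt.of_eq fun e => four_mul_toNat_lt_iff (hr0 e) (hrle e))

end EntropyIrr

theorem theorem3p6_general (f : ℕ → ℕ) (hf : Computable f) (hmono : Monotone f)
    (hsum : ¬ Summable fun n : ℕ => (f n : ℝ) / (n : ℝ) ^ 2) (d : ℕ) (hd : 1 ≤ d) :
    (∀ α : ℝ, 0 ≤ α → EntropyIrr.IsPi1Computable α → ∀ k : ℕ, (2 : ℝ) ^ α ≤ k →
      ∃ X : EntropyIrr.ZSubshift d k,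
        EntropyIrr.IsDecidable X ∧ EntropyIrr.IsIrreducible f X ∧ EntropyIrr.HasEntropy X α) ∧
    (∀ k : ℕ, 2 ≤ k → ¬ ∃ alg : Nat.Partrec.Code × ℕ →. ℤ × ℕ,
      Partrec alg ∧ EntropyIrr.ComputesEntropy f d k alg) := by
  obtain ⟨d, rfl⟩ := Nat.exists_eq_add_of_le' hd
  refine ⟨fun α hα hpi k hk => ?_, fun k hk => ?_⟩
  · have hk0 : 0 < k := by exact_mod_cast (Real.rpow_pos_of_pos two_pos α).trans_le hk
    obtain ⟨K, rfl⟩ := Nat.exists_eq_add_of_le' hk0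
    exact EntropyIrr.exists_decidable_irreducible hf hmono hsum d hα hpi (by exact_mod_cast hk)
  · obtain ⟨K, rfl⟩ := Nat.exists_eq_add_of_le' hk
    exact EntropyIrr.not_exists_computesEntropy hf hmono hsum d (Nat.le_add_left 1 K)

theorem theorem3p6 (f : ℕ → ℕ) (hf : Computable f) (hmono : Monotone f)
    (hstep : ∀ n, (f (n + 1) : ℤ) - (f n : ℤ) ∈ ({0, 1} : Set ℤ))
    (hsum : Filter.Tendsto (fun N : ℕ => ∑ n ∈ Finset.Icc 1 N, (f n : ℝ) / (n : ℝ) ^ 2)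
      Filter.atTop Filter.atTop)
    (d : ℕ) (hd : 1 ≤ d) :
    (∀ α : ℝ, 0 < α → EntropyIrr.IsPi1Computable α →
      ∃ (k : ℕ) (X : EntropyIrr.ZSubshift d k),
        EntropyIrr.IsDecidable X ∧ EntropyIrr.IsIrreducible f X ∧ EntropyIrr.HasEntropy X α) ∧
    (∃ k : ℕ, ¬ ∃ alg : Nat.Partrec.Code × ℕ →. ℤ × ℕ,
      Partrec alg ∧ EntropyIrr.ComputesEntropy f d k alg) := by
  obtain ⟨hexists, hnot⟩ := theorem3p6_general f hf hmono
    (EntropyIrr.not_summable_of_tendsto_sum_Icc (fun n => by positivity) hsum) d hd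
  refine ⟨fun α hα hpi => ?_, 2, hnot 2 le_rfl⟩
  obtain ⟨k, hk⟩ := exists_nat_ge ((2 : ℝ) ^ α)
  exact ⟨k, hexists α hα.le hpi k hk⟩
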